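/- Let $\mathcal V$ be a finite dimensional real vector space with a positive semi-definite symmetric bilinear form $(\cdot,\cdot)$ and put $\mathcal V^0=\{v\in\mathcal V:(v,v)=0\}$. For $R\subseteq\mathcal V$ let $R^0=R\cap\mathcal V^0$ and $R^\times=R\setminus R^0$. The set $R$ is an extended affine root system (EARS) in $\mathcal V$ if: (R1) $0\in R$; (R2) $-R=R$; (R3) $R$ spans $\mathcal V$; (R4) $\alpha\in R^\times$ implies $2\alpha\notin R$; (R5) $R$ is discrete in $\mathcal V$; (R6) for $\alpha\in R^\times$ and $\beta\in R$ there are $d,u\in\mathbb Z_{\ge0}$ with $\{\beta+n\alpha:n\in\mathbb Z\}\cap R=\{\beta-d\alpha,\dots,\beta+u\alpha\}$ and $d-u=2\frac{(\alpha,\beta)}{(\alpha,\alpha)}$; (R7) $R^\times$ is not a disjoint union of two nonempty subsets that are orthogonal to each other; (R8) for every $\sigma\in R^0$ there is $\alpha\in R^\times$ with $\alpha+\sigma\in R$. Choose a complement $\dot{\mathcal V}$ of $\mathcal V^0$ in $\mathcal V$, and let $V=\mathcal V^0\oplus\dot{\mathcal V}\oplus(\mathcal V^0)^*$ with the form $\langle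 (v_1,v_2,v_3),(u_1,u_2,u_3)\rangle=u_3(v_1)+(v_2,u_2)+v_3(u_1)$, which extends $(\cdot,\cdot)$ on $\mathcal V=\mathcal V^0\oplus\dot{\mathcal V}$. For $\alpha\in R^\times$ let $r_\alpha(v)=v-2\frac{\langle v,\alpha\rangle}{\langle\alpha,\alpha\rangle}\alpha$ on $V$. The extended affine Weyl group $\mathcal W$ of $R$ is the subgroup of $\mathrm{Aut}(V)$ generated by all $r_\alpha$, $\alpha\in R^\times$. The image $\overline{R^\times}$ of $R^\times$ in $\mathcal V/\mathcal V^0$ is an irreducible finite root system (possibly non-reduced); the type of $R$ is the type, i.e. the isomorphism class, of $\overline{R^\times}$. Let $R$ be an EARS in $\mathcal V$ with extended affine Weyl group $\mathcal W$, and let $\beta\in R^\times$ be such that the reflections $r_\alpha$ with $\alpha\in\widetilde{R^\times}:=R^\times\setminus\mathcal W.\beta$ generate $\mathcal W$. Then there is an EARS $\tilde R$ in $\mathcal V$ whose set of anisotropic roots $\tilde R^\times$ is $\widetilde{R^\times}$. Moreover, every such $\tilde R$ either has the same type as $R$, or the types of $R$ and $\tilde R$ are related by one of $$BC_1\to A_1,\qquad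 BC_2\to B_2,\qquad BC_\ell\to B_\ell,\qquad BC_\ell\to C_\ell\qquad(\ell\ge3).$$ -/

import Mathlib

namespace EARS

noncomputable section

variable {𝒱 : Type*} [AddCommGroup 𝒱] [Module ℝ 𝒱]

/-- `R⁰`: the vectors of `R` with `(v, v) = 0`. -/
def isotropicPart (B : LinearMap.BilinForm ℝ 𝒱) (R : Set 𝒱) : Set 𝒱 :=
  {α ∈ R | B α α = 0}

/-- `R^×`: the vectors of `R` with `(v, v) ≠ 0`. -/
def anisotropicPart (B : LinearMap.BilinForm ℝ 𝒱) (R : Set 𝒱) : Set 𝒱 :=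
  {α ∈ R | B α α ≠ 0}

/-- Extended affine root systems in a finite dimensional real vector space `𝒱` with a form `B`
(which is positive semi-definite and symmetric wherever this is used). The topology of `𝒱` is the
usual (unique Hausdorff vector space) topology. -/
structure IsEARS [TopologicalSpace 𝒱] (B : LinearMap.BilinForm ℝ 𝒱) (R : Set 𝒱) : Prop where
  zero_mem : (0 : 𝒱) ∈ R
  neg_eq : {α : 𝒱 | -α ∈ R} = R
  span_eq_top : Submodule.span ℝ R = ⊤
  two_smul_notMem : ∀ α ∈ anisotropicPart B R, (2 : ℝ) • α ∉ R
  discrete : IsDiscrete R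
  /-- Root strings are unbroken, and `d - u` is the Cartan number. -/
  root_string : ∀ α ∈ anisotropicPart B R, ∀ β ∈ R, ∃ d u : ℕ,
    {γ : 𝒱 | ∃ n : ℤ, γ = β + n • α} ∩ R =
      {γ : 𝒱 | ∃ n : ℤ, -(d : ℤ) ≤ n ∧ n ≤ (u : ℤ) ∧ γ = β + n • α} ∧
    (d : ℝ) - (u : ℝ) = 2 * (B α β / B α α)
  irreducible : ¬ ∃ R₁ R₂ : Set 𝒱, R₁.Nonempty ∧ R₂.Nonempty ∧ Disjoint R₁ R₂ ∧
    R₁ ∪ R₂ = anisotropicPart B R ∧ ∀ α ∈ R₁, ∀ β ∈ R₂, B α β = 0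
  exists_add_mem : ∀ σ ∈ isotropicPart B R, ∃ α ∈ anisotropicPart B R, α + σ ∈ R

/-- `𝒱⁰`, defined as the radical of the form; see `mem_nullspace`. -/
abbrev nullspace (B : LinearMap.BilinForm ℝ 𝒱) : Submodule ℝ 𝒱 := LinearMap.ker B

theorem mem_nullspace {B : LinearMap.BilinForm ℝ 𝒱} (hB : B.IsPosSemidef) (v : 𝒱) :
    v ∈ nullspace B ↔ B v v = 0 :=
  (LinearMap.BilinForm.apply_apply_same_eq_zero_iff B hB.isNonneg.nonneg
    ⟨fun x y => hB.isSymm.eq x y⟩).symm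

/-! ### The extended affine Weyl group -/

/-- The space `V = 𝒱⁰ ⊕ 𝒱̇ ⊕ (𝒱⁰)^*`, with `𝒱 = 𝒱⁰ ⊕ 𝒱̇` kept in one piece. -/
abbrev HypSpace (B : LinearMap.BilinForm ℝ 𝒱) : Type _ :=
  𝒱 × Module.Dual ℝ (nullspace B)

/-- The form `⟨·,·⟩` on `V`. It depends on the complement `D = 𝒱̇` of `𝒱⁰` in `𝒱`: it extends `B`,
makes `(𝒱⁰)^*` isotropic and orthogonal to `D`, and is the natural pairing on `𝒱⁰ × (𝒱⁰)^*`.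
So `⟨(v, f), (w, g)⟩ = (v, w) + g(v⁰) + f(w⁰)`, where `v⁰` is the `𝒱⁰`-component of `v`. -/
def hypForm (B : LinearMap.BilinForm ℝ 𝒱) (D : Submodule ℝ 𝒱) (hD : IsCompl (nullspace B) D) :
    LinearMap.BilinForm ℝ (HypSpace B) :=
  LinearMap.mk₂ ℝ
    (fun x y => B x.1 y.1 + y.2 ((nullspace B).projectionOnto D hD x.1)
      + x.2 ((nullspace B).projectionOnto D hD y.1))
    (by intro x x' y; simp; ring)
    (by intro c x y; simp; ring)
    (by intro x y y'; simp; ring)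
    (by intro c x y; simp; ring)

/-- The reflection `r_a(v) = v - 2 ⟨v, a⟩ / ⟨a, a⟩ a`, for a form on a real vector space
(the identity, by the convention on division by zero, if `⟨a, a⟩ = 0`). -/
def reflection {V : Type*} [AddCommGroup V] [Module ℝ V] (Φ : LinearMap.BilinForm ℝ V) (a : V) :
    V ≃ₗ[ℝ] V :=
  LinearEquiv.ofInvolutive
    (LinearMap.id - LinearMap.toSpanSingleton ℝ V a ∘ₗ ((2 / Φ a a) • Φ.flip a))
    (by
      intro v
      by_cases h : Φ a a = 0
      · simp [h]
      · have h2 : 2 / Φ a a * Φ a a = 2 := div_mul_cancel₀ _ h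
        change (v - (2 / Φ a a * Φ v a) • a) - (2 / Φ a a * Φ (v - (2 / Φ a a * Φ v a) • a) a) • a
          = v
        rw [map_sub, map_smul, LinearMap.sub_apply, LinearMap.smul_apply, smul_eq_mul]
        rw [show 2 / Φ a a * (Φ v a - 2 / Φ a a * Φ v a * Φ a a) = -(2 / Φ a a * Φ v a) by
          linear_combination (-(2 / Φ a a * Φ v a)) * h2]
        module)

theorem reflection_apply {V : Type*} [AddCommGroup V] [Module ℝ V] (Φ : LinearMap.BilinForm ℝ V)
    (a v : V) : reflection Φ a v = v - (2 * Φ v a / Φ a a) • a := by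
  change v - (2 / Φ a a * Φ v a) • a = _
  rw [div_mul_eq_mul_div]

/-- The subgroup of `Aut(V)` generated by the reflections `r_α`, `α ∈ S`, where `S ⊆ 𝒱 ⊆ V`.
For `S = R^×` this is the extended affine Weyl group of `R`. -/
def reflectionGroup (B : LinearMap.BilinForm ℝ 𝒱) (D : Submodule ℝ 𝒱)
    (hD : IsCompl (nullspace B) D) (S : Set 𝒱) : Subgroup (HypSpace B ≃ₗ[ℝ] HypSpace B) :=
  Subgroup.closure {g | ∃ α ∈ S, g = reflection (hypForm B D hD) (α, 0)}

/-- The extended affine Weyl group of `R`. -/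
def weylGroup (B : LinearMap.BilinForm ℝ 𝒱) (D : Submodule ℝ 𝒱)
    (hD : IsCompl (nullspace B) D) (R : Set 𝒱) : Subgroup (HypSpace B ≃ₗ[ℝ] HypSpace B) :=
  reflectionGroup B D hD (anisotropicPart B R)

/-- `R^× \ 𝒲.β`. -/
def removeOrbit (B : LinearMap.BilinForm ℝ 𝒱) (D : Submodule ℝ 𝒱)
    (hD : IsCompl (nullspace B) D) (R : Set 𝒱) (β : 𝒱) : Set 𝒱 :=
  {α ∈ anisotropicPart B R |
    ¬ ∃ w ∈ weylGroup B D hD R, w ((β, 0) : HypSpace B) = ((α, 0) : HypSpace B)}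

/-! ### Types -/

/-- The finite root system (without zero) obtained from `R^×` in `𝒱 / 𝒱⁰`. -/
def quotientRoots (B : LinearMap.BilinForm ℝ 𝒱) (R : Set 𝒱) : Set (𝒱 ⧸ nullspace B) :=
  (nullspace B).mkQ '' anisotropicPart B R

/-- Isomorphism of (finite, spanning) root systems: a linear isomorphism of the ambient spaces that
maps one set of roots onto the other. The type of a root system is its isomorphism class. -/
def RootIso {E F : Type*} [AddCommGroup E] [Module ℝ E] [AddCommGroup F] [Module ℝ F]
    (Φ : Set E) (Ψ : Set F) : Prop :=
  ∃ e : E ≃ₗ[ℝ] F, e '' Φ = Ψ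

/-- The short roots `±eᵢ` of `B_ℓ`. -/
def unitRoots (l : ℕ) : Set (Fin l → ℝ) :=
  {v | ∃ i, v = Pi.single i 1 ∨ v = -Pi.single i 1}

/-- The roots `±eᵢ ± eⱼ`, `i ≠ j`. -/
def middleRoots (l : ℕ) : Set (Fin l → ℝ) :=
  {v | ∃ i j, i ≠ j ∧ (v = Pi.single i 1 + Pi.single j 1 ∨ v = Pi.single i 1 - Pi.single j 1 ∨
    v = -Pi.single i 1 - Pi.single j 1)}

/-- The roots `±2eᵢ`. -/
def doubleRoots (l : ℕ) : Set (Fin l → ℝ) :=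
  {v | ∃ i, v = Pi.single i 2 ∨ v = -Pi.single i 2}

/-- The root system of type `A₁`. -/
def rootsA₁ : Set ℝ := {1, -1}

/-- The root system of type `B_ℓ`. -/
def rootsB (l : ℕ) : Set (Fin l → ℝ) := unitRoots l ∪ middleRoots l

/-- The root system of type `C_ℓ`. -/
def rootsC (l : ℕ) : Set (Fin l → ℝ) := middleRoots l ∪ doubleRoots l

/-- The root system of type `BC_ℓ`. -/
def rootsBC (l : ℕ) : Set (Fin l → ℝ) := unitRoots l ∪ middleRoots l ∪ doubleRoots l

/-- `R` has the type of the finite root system `Φ`: its quotient root system is isomorphic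
to `Φ`. -/
def HasType (B : LinearMap.BilinForm ℝ 𝒱) (R : Set 𝒱) {E : Type*} [AddCommGroup E] [Module ℝ E]
    (Φ : Set E) : Prop :=
  RootIso (quotientRoots B R) Φ

/-- `R` and `R'` have the same type. -/
def SameType (B : LinearMap.BilinForm ℝ 𝒱) (R R' : Set 𝒱) : Prop :=
  RootIso (quotientRoots B R) (quotientRoots B R')

end

end EARS

/-! Put `S = R^× \ 𝒲β`. It is stable under all reflections in `R^×`, and only the action of the Weyl
group on `𝒱` matters.

Existence: adjoin to `S` the isotropic differences of its elements (`withIsotropic`). Strings stay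
unbroken because `(y, α) < 0` puts `y + α` in the new set: Cartan integers of product at most `4`
make it a reflected root or an isotropic difference (`add_mem_withIsotropic`). If `S` split into two
orthogonal parts, then `r_β`, being generated by `S`, would force `β` to be orthogonal to one of
them; so would be its orbit, and `R^×` would split.

Types: if the class of `β` modulo `𝒱⁰` survives in the image of `S`, so does its orbit, and the
quotient root systems agree. Otherwise some root of `S` is proportional to `β` modulo `𝒱⁰`
(`IsWeylStable.exists_proportional`). Indeed, take the product of the functionals `(δ, ·)`, one from
each pair `±`, for `δ` in the orbit of `β`. It changes sign under `r_β`, but with no such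
proportional root every reflection in `S` fixes it. Proportional roots that are not equal up to sign
give roots `a` and `2a`. The roots of the length of `a` whose doubles are roots then form an
orthogonal basis up to sign, and irreducibility yields `BC_ℓ` (`IsRootSet.mem_iff`). The removed
classes have one length and form either all `±eᵢ`, leaving `C_ℓ`, or all `±2eᵢ`, leaving `B_ℓ`. -/

namespace EARS

variable {𝒱 : Type*} [AddCommGroup 𝒱] [Module ℝ 𝒱] {B : LinearMap.BilinForm ℝ 𝒱}

/-! ### The action of the extended affine Weyl group on `𝒱` -/

/-- The group of automorphisms of `𝒱` generated by the reflections in `S`. -/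
def linearWeyl (B : LinearMap.BilinForm ℝ 𝒱) (S : Set 𝒱) : Subgroup (𝒱 ≃ₗ[ℝ] 𝒱) :=
  Subgroup.closure {g | ∃ α ∈ S, g = reflection B α}

theorem reflection_mem_linearWeyl {S : Set 𝒱} {α : 𝒱} (h : α ∈ S) :
    reflection B α ∈ linearWeyl B S :=
  Subgroup.subset_closure ⟨α, h, rfl⟩

theorem reflection_hypForm_apply (D : Submodule ℝ 𝒱) (hD : IsCompl (nullspace B) D) (α v : 𝒱) :
    reflection (hypForm B D hD) (α, 0) (v, 0) = (reflection B α v, 0) := by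
  simp [reflection_apply, hypForm]

theorem exists_mem_linearWeyl {D : Submodule ℝ 𝒱} {hD : IsCompl (nullspace B) D} {S : Set 𝒱}
    {w : HypSpace B ≃ₗ[ℝ] HypSpace B} (hw : w ∈ reflectionGroup B D hD S) :
    ∃ g ∈ linearWeyl B S, ∀ v : 𝒱, w (v, 0) = (g v, 0) := by
  refine Subgroup.closure_induction (p := fun w _ =>
    ∃ g ∈ linearWeyl B S, ∀ v : 𝒱, w (v, 0) = (g v, 0)) ?_ ?_ ?_ ?_ hw
  · rintro _ ⟨α, hα, rfl⟩
    exact ⟨_, reflection_mem_linearWeyl hα, reflection_hypForm_apply D hD α⟩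
  · exact ⟨1, one_mem _, fun v => rfl⟩
  · rintro x y - - ⟨g, hg, hx⟩ ⟨k, hk, hy⟩
    exact ⟨g * k, mul_mem hg hk, fun v => by simp [LinearEquiv.mul_apply, hx, hy]⟩
  · rintro x - ⟨g, hg, hx⟩
    refine ⟨g⁻¹, inv_mem hg, fun v => ?_⟩
    have h := hx (g⁻¹ v)
    rw [LinearEquiv.coe_inv, LinearEquiv.apply_symm_apply] at h
    rw [LinearEquiv.coe_inv, LinearEquiv.symm_apply_eq, LinearEquiv.coe_inv, h]

theorem exists_mem_reflectionGroup (D : Submodule ℝ 𝒱) (hD : IsCompl (nullspace B) D) {S : Set 𝒱}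
    {g : 𝒱 ≃ₗ[ℝ] 𝒱} (hg : g ∈ linearWeyl B S) :
    ∃ w ∈ reflectionGroup B D hD S, ∀ v : 𝒱, w (v, 0) = (g v, 0) := by
  refine Subgroup.closure_induction (p := fun g _ =>
    ∃ w ∈ reflectionGroup B D hD S, ∀ v : 𝒱, w (v, 0) = (g v, 0)) ?_ ?_ ?_ ?_ hg
  · rintro _ ⟨α, hα, rfl⟩
    exact ⟨_, Subgroup.subset_closure ⟨α, hα, rfl⟩, reflection_hypForm_apply D hD α⟩
  · exact ⟨1, one_mem _, fun v => rfl⟩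
  · rintro x y - - ⟨g, hg, hx⟩ ⟨k, hk, hy⟩
    exact ⟨g * k, mul_mem hg hk, fun v => by simp [LinearEquiv.mul_apply, hx, hy]⟩
  · rintro x - ⟨w, hw, hx⟩
    refine ⟨w⁻¹, inv_mem hw, fun v => ?_⟩
    have h := hx (x⁻¹ v)
    rw [LinearEquiv.coe_inv, LinearEquiv.apply_symm_apply] at h
    rw [LinearEquiv.coe_inv, LinearEquiv.symm_apply_eq, LinearEquiv.coe_inv, h]

/-- Both groups preserve `𝒱 × 0` and restrict there to the groups generated by the reflections of
`𝒱`, so the generation hypothesis descends to `𝒱`. -/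
theorem linearWeyl_le_of_reflectionGroup_le {D : Submodule ℝ 𝒱} {hD : IsCompl (nullspace B) D}
    {S T : Set 𝒱} (h : reflectionGroup B D hD S ≤ reflectionGroup B D hD T) :
    linearWeyl B S ≤ linearWeyl B T := by
  intro g hg
  obtain ⟨w, hw, hwg⟩ := exists_mem_reflectionGroup D hD hg
  obtain ⟨k, hk, hwk⟩ := exists_mem_linearWeyl (h hw)
  have : g = k := LinearEquiv.ext fun v => (Prod.ext_iff.1 ((hwg v).symm.trans (hwk v))).1
  exact this ▸ hk

theorem mem_removeOrbit {D : Submodule ℝ 𝒱} {hD : IsCompl (nullspace B) D} {R : Set 𝒱}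
    {α β : 𝒱} : α ∈ removeOrbit B D hD R β ↔
      α ∈ anisotropicPart B R ∧ ∀ g ∈ linearWeyl B (anisotropicPart B R), g β ≠ α := by
  refine and_congr_right fun _ => ⟨fun h g hg hgβ => h ?_, fun h => ?_⟩
  · obtain ⟨w, hw, hwg⟩ := exists_mem_reflectionGroup D hD hg
    exact ⟨w, hw, by rw [hwg, hgβ]⟩
  · rintro ⟨w, hw, hwβ⟩
    obtain ⟨g, hg, hwg⟩ := exists_mem_linearWeyl hw
    exact h g hg (Prod.ext_iff.1 ((hwg β).symm.trans hwβ)).1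

/-! ### Reflections and positive semi-definite forms -/

theorem reflection_self {α : 𝒱} (h : B α α ≠ 0) : reflection B α α = -α := by
  rw [reflection_apply, mul_div_assoc, div_self h]; module

theorem reflection_of_apply_eq_zero {α v : 𝒱} (h : B v α = 0) : reflection B α v = v := by
  simp [reflection_apply, h]

theorem reflection_of_two_mul_eq {α v : 𝒱} (h : B α α ≠ 0) {n : ℤ} (hn : 2 * B v α = n * B α α) :
    reflection B α v = v - n • α := by
  rw [reflection_apply, hn, mul_div_assoc, div_self h, mul_one, Int.cast_smul_eq_zsmul]

theorem reflection_reflection (α v : 𝒱) : reflection B α (reflection B α v) = v :=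
  (reflection B α).left_inv v

theorem apply_reflection_reflection (hB : B.IsPosSemidef) (α v w : 𝒱) :
    B (reflection B α v) (reflection B α w) = B v w := by
  by_cases h : B α α = 0
  · simp [reflection_apply, h]
  · simp only [reflection_apply, map_sub, LinearMap.sub_apply, map_smul, LinearMap.smul_apply,
      smul_eq_mul, hB.isSymm.eq α w]
    field_simp
    ring

theorem apply_of_mem_linearWeyl (hB : B.IsPosSemidef) {S : Set 𝒱} {g : 𝒱 ≃ₗ[ℝ] 𝒱}
    (hg : g ∈ linearWeyl B S) (v w : 𝒱) : B (g v) (g w) = B v w := by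
  refine Subgroup.closure_induction (p := fun g _ => ∀ v w, B (g v) (g w) = B v w)
    ?_ ?_ ?_ ?_ hg v w
  · rintro _ ⟨α, -, rfl⟩
    exact apply_reflection_reflection hB α
  · exact fun v w => rfl
  · intro x y _ _ hx hy v w
    rw [LinearEquiv.mul_apply, LinearEquiv.mul_apply, hx, hy]
  · intro x _ hx v w
    rw [← hx, LinearEquiv.coe_inv, LinearEquiv.apply_symm_apply, LinearEquiv.apply_symm_apply]

/-- A set that is mapped to itself by reflections is mapped to itself by the group they generate. -/
theorem apply_mem_of_mem_linearWeyl {S T : Set 𝒱}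
    (h : ∀ α ∈ S, ∀ v ∈ T, reflection B α v ∈ T) {g : 𝒱 ≃ₗ[ℝ] 𝒱} (hg : g ∈ linearWeyl B S)
    {v : 𝒱} (hv : v ∈ T) : g v ∈ T := by
  -- The equivalence, rather than one implication, makes the inverse case go through.
  refine (Subgroup.closure_induction (p := fun g _ => ∀ v, g v ∈ T ↔ v ∈ T)
    ?_ ?_ ?_ ?_ hg v).2 hv
  · rintro _ ⟨α, hα, rfl⟩ v
    exact ⟨fun hv => reflection_reflection (B := B) α v ▸ h α hα _ hv, h α hα v⟩
  · exact fun v => Iff.rfl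
  · intro x y _ _ hx hy v
    rw [LinearEquiv.mul_apply, hx, hy]
  · intro x _ hx v
    rw [← hx, LinearEquiv.coe_inv, LinearEquiv.apply_symm_apply]

theorem sub_mem_span_of_mem_linearWeyl {S : Set 𝒱} {g : 𝒱 ≃ₗ[ℝ] 𝒱} (hg : g ∈ linearWeyl B S)
    (v : 𝒱) : g v - v ∈ Submodule.span ℝ S := by
  refine Subgroup.closure_induction (p := fun g _ => ∀ v, g v - v ∈ Submodule.span ℝ S)
    ?_ ?_ ?_ ?_ hg v
  · rintro _ ⟨α, hα, rfl⟩ v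
    rw [reflection_apply, sub_sub_cancel_left]
    exact neg_mem (Submodule.smul_mem _ _ (Submodule.subset_span hα))
  · simp
  · intro x y _ _ hx hy v
    simpa [LinearEquiv.mul_apply] using add_mem (hx (y v)) (hy v)
  · intro x _ hx v
    have := neg_mem (hx (x⁻¹ v))
    rwa [LinearEquiv.coe_inv, LinearEquiv.apply_symm_apply, neg_sub] at this

theorem apply_sq_le (hB : B.IsPosSemidef) (v w : 𝒱) : B v w ^ 2 ≤ B v v * B w w := by
  have := LinearMap.BilinForm.apply_mul_apply_le_of_forall_zero_le B hB.isNonneg.nonneg v w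
  rwa [hB.isSymm.eq w v, ← sq] at this

theorem apply_self_pos (hB : B.IsPosSemidef) {α : 𝒱} (h : B α α ≠ 0) : 0 < B α α :=
  lt_of_le_of_ne (hB.isNonneg.nonneg α) h.symm

theorem apply_eq_zero_of_isotropic (hB : B.IsPosSemidef) {σ : 𝒱} (h : B σ σ = 0) : B σ = 0 :=
  (mem_nullspace hB σ).2 h

theorem apply_eq_zero_of_isotropic' (hB : B.IsPosSemidef) {σ : 𝒱} (h : B σ σ = 0) (v : 𝒱) :
    B v σ = 0 := by
  rw [hB.isSymm.eq, apply_eq_zero_of_isotropic hB h, LinearMap.zero_apply]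

/-- The product of two Cartan integers is at most `4`. -/
theorem cartan_mul_le (hB : B.IsPosSemidef) {x y : 𝒱} (hx : B x x ≠ 0) (hy : B y y ≠ 0) {m n : ℤ}
    (hm : 2 * B x y = m * B y y) (hn : 2 * B y x = n * B x x) : m * n ≤ 4 := by
  have h := apply_sq_le hB x y
  have hxy := mul_pos (apply_self_pos hB hx) (apply_self_pos hB hy)
  rw [hB.isSymm.eq y x] at hn
  have h1 : (m * n : ℝ) * (B x x * B y y) = 4 * B x y ^ 2 := by
    linear_combination (-(n : ℝ) * B x x) * hm - 2 * B x y * hn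
  have h2 : (m * n : ℝ) ≤ 4 := by
    by_contra! h3
    nlinarith
  exact_mod_cast h2

/-! ### Consequences of the axioms -/

namespace IsEARS

variable [TopologicalSpace 𝒱] {R : Set 𝒱}

theorem neg_mem (hR : IsEARS B R) {α : 𝒱} (h : α ∈ R) : -α ∈ R := by
  have : α ∈ {α : 𝒱 | -α ∈ R} := by rwa [hR.neg_eq]
  exact this

/-- The Cartan number is `d - u`, and `-d ≤ u - d ≤ u`, so the string contains the reflected root `β
+ (u - d)α`. -/
theorem exists_cartan (hB : B.IsPosSemidef) (hR : IsEARS B R) {α β : 𝒱}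
    (hα : α ∈ anisotropicPart B R) (hβ : β ∈ R) :
    ∃ n : ℤ, 2 * B β α = n * B α α ∧ reflection B α β ∈ R := by
  obtain ⟨d, u, h, hdu⟩ := hR.root_string α hα β hβ
  have hn : 2 * B β α = ((d - u : ℤ) : ℝ) * B α α := by
    push_cast
    rw [hdu, hB.isSymm.eq β α]
    field_simp [hα.2]
  refine ⟨d - u, hn, ?_⟩
  have : β + (u - d : ℤ) • α ∈ {γ : 𝒱 | ∃ n : ℤ, γ = β + n • α} ∩ R := by
    rw [h]
    exact ⟨_, by omega, by omega, rfl⟩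
  rw [reflection_of_two_mul_eq hα.2 hn, show β - (d - u : ℤ) • α = β + (u - d : ℤ) • α by module]
  exact this.2

theorem reflection_mem_anisotropicPart (hB : B.IsPosSemidef) (hR : IsEARS B R) {α β : 𝒱}
    (hα : α ∈ anisotropicPart B R) (hβ : β ∈ anisotropicPart B R) :
    reflection B α β ∈ anisotropicPart B R := by
  obtain ⟨-, -, h⟩ := hR.exists_cartan hB hα hβ.1
  exact ⟨h, by rw [apply_reflection_reflection hB]; exact hβ.2⟩

/-- The difference of two anisotropic roots is a root if it is isotropic. -/
theorem mem_of_isotropic_of_add_mem (hB : B.IsPosSemidef) (hR : IsEARS B R) {α σ : 𝒱}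
    (hα : α ∈ anisotropicPart B R) (hσ : B σ σ = 0) (h : α + σ ∈ R) : σ ∈ R := by
  obtain ⟨d, u, hs, hdu⟩ := hR.root_string α hα _ h
  -- The Cartan number of `α + σ` along `α` is `2`, so `d ≥ 1` and one step down the string is a
  -- root.
  rw [map_add, apply_eq_zero_of_isotropic' hB hσ, add_zero, div_self hα.2] at hdu
  have hdu' : (d : ℝ) = u + 2 := by linarith
  have hdu' : d = u + 2 := by exact_mod_cast hdu'
  have : α + σ + (-1 : ℤ) • α ∈ {γ : 𝒱 | ∃ n : ℤ, γ = α + σ + n • α} ∩ R := by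
    rw [hs]
    exact ⟨_, by omega, by omega, rfl⟩
  have e : α + σ + (-1 : ℤ) • α = σ := by module
  exact e ▸ this.2

/-- By (R8) an isotropic root is a difference of two anisotropic ones. -/
theorem span_anisotropicPart (hB : B.IsPosSemidef) (hR : IsEARS B R) :
    Submodule.span ℝ (anisotropicPart B R) = ⊤ := by
  rw [← top_le_iff, ← hR.span_eq_top, Submodule.span_le]
  intro α hα
  by_cases h : B α α = 0
  · obtain ⟨γ, hγ, hγα⟩ := hR.exists_add_mem α ⟨hα, h⟩
    have h2 : γ + α ∈ anisotropicPart B R := by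
      refine ⟨hγα, ?_⟩
      rw [map_add, map_add, LinearMap.add_apply, LinearMap.add_apply,
        apply_eq_zero_of_isotropic' hB h, apply_eq_zero_of_isotropic hB h]
      simpa using hγ.2
    simpa using sub_mem (Submodule.subset_span h2 : _ ∈ Submodule.span ℝ (anisotropicPart B R))
      (Submodule.subset_span hγ)
  · exact Submodule.subset_span ⟨hα, h⟩

end IsEARS

/-! ### Removing an orbit -/

/-- An unbroken symmetric string of integers. -/
theorem exists_string {I : Set ℤ} (h0 : (0 : ℤ) ∈ I) {N n₀ : ℤ} (hbd : ∀ n ∈ I, N ≤ n)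
    (hsymm : ∀ n ∈ I, -n₀ - n ∈ I) (hstep : ∀ n ∈ I, 2 * n + n₀ < 0 → n + 1 ∈ I) :
    ∃ d u : ℕ, (∀ n, n ∈ I ↔ -(d : ℤ) ≤ n ∧ n ≤ u) ∧ (d : ℤ) - u = n₀ := by
  obtain ⟨m, hm, hmin⟩ := Int.exists_least_of_bdd (P := (· ∈ I)) ⟨N, hbd⟩ ⟨0, h0⟩
  have hm0 := hmin 0 h0
  have hm1 := hmin _ (hsymm 0 h0)
  have hup : ∀ k : ℕ, 2 * (m + k - 1) + n₀ < 0 → m + k ∈ I := by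
    intro k
    induction k with
    | zero => intro _; simpa using hm
    | succ k ih =>
      intro hk
      push_cast at hk ⊢
      rw [← add_assoc]
      exact hstep _ (ih (by omega)) (by omega)
  have hup' : ∀ n, m ≤ n → 2 * (n - 1) + n₀ < 0 → n ∈ I := by
    intro n hn h
    obtain ⟨k, rfl⟩ := Int.le.dest hn
    exact hup k h
  -- The least element is `m`, so by symmetry the greatest is `-n₀ - m`; `0 ∈ I` makes both
  -- truncations harmless. Elements up to the centre are reached by climbing from `m`, the others by
  -- mirroring.
  refine ⟨(-m).toNat, (-n₀ - m).toNat, fun n => ⟨fun hn => ?_, fun hn => ?_⟩, by omega⟩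
  · have h1 := hmin _ hn
    have h2 := hmin _ (hsymm n hn)
    omega
  · by_cases h : 2 * (n - 1) + n₀ < 0
    · exact hup' n (by omega) h
    · have := hsymm _ (hup' (-n₀ - n) (by omega) (by omega))
      simpa using this

/-- The candidate for the root system with anisotropic part `S`. -/
def withIsotropic (B : LinearMap.BilinForm ℝ 𝒱) (S : Set 𝒱) : Set 𝒱 :=
  S ∪ {σ | B σ σ = 0 ∧ ∃ α ∈ S, α + σ ∈ S}

/-- The conditions on a subset of the anisotropic roots under which it is the anisotropic part of
an extended affine root system. -/
structure IsWeylStable [TopologicalSpace 𝒱] (B : LinearMap.BilinForm ℝ 𝒱) (R S : Set 𝒱) : Prop where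
  subset : S ⊆ anisotropicPart B R
  reflection_mem : ∀ α ∈ anisotropicPart B R, ∀ x ∈ S, reflection B α x ∈ S

namespace IsWeylStable

variable [TopologicalSpace 𝒱] {R S : Set 𝒱}

theorem neg_mem (hS : IsWeylStable B R S) {α : 𝒱} (hα : α ∈ S) : -α ∈ S :=
  reflection_self (hS.subset hα).2 ▸ hS.reflection_mem α (hS.subset hα) α hα

theorem withIsotropic_subset (hB : B.IsPosSemidef) (hR : IsEARS B R) (hS : IsWeylStable B R S) :
    withIsotropic B S ⊆ R := by
  rintro x (hx | ⟨h0, α, hα, hαx⟩)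
  · exact (hS.subset hx).1
  · exact hR.mem_of_isotropic_of_add_mem hB (hS.subset hα) h0 (hS.subset hαx).1

theorem anisotropicPart_withIsotropic (hS : IsWeylStable B R S) :
    anisotropicPart B (withIsotropic B S) = S := by
  ext x
  constructor
  · rintro ⟨hx | hx, h⟩
    · exact hx
    · exact absurd hx.1 h
  · exact fun hx => ⟨Or.inl hx, (hS.subset hx).2⟩

/-- For `y ∈ S` both Cartan integers are negative with product at most `4`. If one is `-1`, then `y
+ α` is a reflection of `y` or `α`. Otherwise both are `-2`, and `y + α` is isotropic and equal to
the difference of `y` and `-α`. -/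
theorem add_mem_withIsotropic (hB : B.IsPosSemidef) (hR : IsEARS B R) (hS : IsWeylStable B R S)
    {α y : 𝒱} (hα : α ∈ S) (hy : y ∈ withIsotropic B S) (h : B y α < 0) :
    y + α ∈ withIsotropic B S := by
  obtain hy | hy := hy
  swap
  · rw [apply_eq_zero_of_isotropic hB hy.1] at h
    exact absurd h (lt_irrefl _)
  have hα' := hS.subset hα
  have hy' := hS.subset hy
  obtain ⟨m, hm, -⟩ := hR.exists_cartan hB hα' hy'.1
  obtain ⟨n, hn, -⟩ := hR.exists_cartan hB hy' hα'.1
  have hmn := cartan_mul_le hB hy'.2 hα'.2 hm hn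
  have hαp := apply_self_pos hB hα'.2
  have hyp := apply_self_pos hB hy'.2
  have hm0 : m < 0 := by
    have : (m : ℝ) < 0 := by by_contra! h'; nlinarith
    exact_mod_cast this
  have hn0 : n < 0 := by
    have : (n : ℝ) < 0 := by rw [hB.isSymm.eq] at hn; by_contra! h'; nlinarith
    exact_mod_cast this
  rcases eq_or_ne m (-1) with rfl | hm1
  · left
    have := hS.reflection_mem α hα' y hy
    rw [reflection_of_two_mul_eq hα'.2 hm] at this
    simpa using this
  rcases eq_or_ne n (-1) with rfl | hn1
  · left
    have := hS.reflection_mem y hy' α hα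
    rw [reflection_of_two_mul_eq hy'.2 hn] at this
    simpa [add_comm] using this
  have hm2 : m = -2 := by nlinarith [show m ≤ -2 by omega, show n ≤ -2 by omega]
  have hn2 : n = -2 := by subst hm2; omega
  subst hm2 hn2
  right
  refine ⟨?_, -α, hS.neg_mem hα, by simpa using hy⟩
  rw [hB.isSymm.eq α y] at hn
  push_cast at hm hn
  simp only [map_add, LinearMap.add_apply, hB.isSymm.eq α y]
  linarith

theorem reflection_mem_withIsotropic (hB : B.IsPosSemidef) (hS : IsWeylStable B R S)
    {α y : 𝒱} (hα : α ∈ S) (hy : y ∈ withIsotropic B S) :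
    reflection B α y ∈ withIsotropic B S := by
  obtain hy | hy := hy
  · exact Or.inl (hS.reflection_mem α (hS.subset hα) y hy)
  · rw [reflection_of_apply_eq_zero (by rw [apply_eq_zero_of_isotropic hB hy.1]; rfl)]
    exact Or.inr hy

/-- The admissible `n` are bounded below by the string in `R`, symmetric under `r_α`, and closed
under `n ↦ n + 1` left of the centre, so `exists_string` applies. -/
theorem root_string (hB : B.IsPosSemidef) (hR : IsEARS B R) (hS : IsWeylStable B R S)
    {α x : 𝒱} (hα : α ∈ S) (hx : x ∈ withIsotropic B S) : ∃ d u : ℕ,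
    {γ : 𝒱 | ∃ n : ℤ, γ = x + n • α} ∩ withIsotropic B S =
      {γ : 𝒱 | ∃ n : ℤ, -(d : ℤ) ≤ n ∧ n ≤ (u : ℤ) ∧ γ = x + n • α} ∧
    (d : ℝ) - (u : ℝ) = 2 * (B α x / B α α) := by
  have hα' := hS.subset hα
  have hxR := hS.withIsotropic_subset hB hR hx
  have hαp := apply_self_pos hB hα'.2
  have hα0 : α ≠ 0 := by rintro rfl; simp at hαp
  obtain ⟨n₀, hn₀, -⟩ := hR.exists_cartan hB hα' hxR
  obtain ⟨dR, uR, hs, -⟩ := hR.root_string α hα' x hxR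
  have hinj : ∀ m n : ℤ, x + m • α = x + n • α → m = n := fun m n h =>
    by
      have h' := add_left_cancel h
      rw [← Int.cast_smul_eq_zsmul ℝ, ← Int.cast_smul_eq_zsmul ℝ] at h'
      exact_mod_cast smul_left_injective ℝ hα0 h'
  have hcart : ∀ n : ℤ, 2 * B (x + n • α) α = ((2 * n + n₀ : ℤ) : ℝ) * B α α := by
    intro n
    rw [← Int.cast_smul_eq_zsmul ℝ]
    simp only [map_add, map_smul, LinearMap.add_apply, LinearMap.smul_apply, smul_eq_mul]
    push_cast
    linarith
  obtain ⟨d, u, hI, hdu⟩ := exists_string (I := {n : ℤ | x + n • α ∈ withIsotropic B S})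
    (N := -dR) (n₀ := n₀) (by simpa using hx)
    (by
      intro n hn
      have : x + n • α ∈ {γ : 𝒱 | ∃ n : ℤ, γ = x + n • α} ∩ R :=
        ⟨⟨n, rfl⟩, hS.withIsotropic_subset hB hR hn⟩
      rw [hs] at this
      obtain ⟨k, hk, -, he⟩ := this
      rwa [hinj _ _ he])
    (by
      intro n hn
      have h := hS.reflection_mem_withIsotropic hB hα hn
      rw [reflection_of_two_mul_eq hα'.2 (hcart n)] at h
      have e : x + n • α - (2 * n + n₀) • α = x + (-n₀ - n) • α := by module
      rwa [e] at h)
    (by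
      intro n hn h
      have h1 : ((2 * n + n₀ : ℤ) : ℝ) < 0 := by exact_mod_cast h
      have := hS.add_mem_withIsotropic hB hR hα hn (by nlinarith [hcart n])
      have e : x + n • α + α = x + (n + 1) • α := by module
      rwa [e] at this)
  refine ⟨d, u, ?_, ?_⟩
  · ext γ
    constructor
    · rintro ⟨⟨n, rfl⟩, h⟩
      exact ⟨n, ((hI n).1 h).1, ((hI n).1 h).2, rfl⟩
    · rintro ⟨n, h1, h2, rfl⟩
      exact ⟨⟨n, rfl⟩, (hI n).2 ⟨h1, h2⟩⟩
  · have : (d : ℝ) - u = n₀ := by exact_mod_cast hdu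
    rw [this, hB.isSymm.eq α x, ← mul_div_assoc, hn₀, mul_div_assoc, div_self hα'.2, mul_one]

/-- A Weyl stable set of roots whose complement is one orbit and whose reflections generate the
Weyl group is the anisotropic part of an extended affine root system. -/
theorem isEARS_withIsotropic (hB : B.IsPosSemidef) (hR : IsEARS B R) (hS : IsWeylStable B R S)
    {β : 𝒱} (hβ : β ∈ anisotropicPart B R)
    (hgen : linearWeyl B (anisotropicPart B R) ≤ linearWeyl B S)
    (horb : ∀ α ∈ anisotropicPart B R, α ∉ S →
      ∃ g ∈ linearWeyl B (anisotropicPart B R), g β = α) :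
    IsEARS B (withIsotropic B S) := by
  -- `r_α` is a product of reflections in `S`, hence `r_α α - α = -2α` lies in the span of `S`.
  have hspan : anisotropicPart B R ⊆ Submodule.span ℝ S := by
    intro α hα
    have := sub_mem_span_of_mem_linearWeyl (hgen (reflection_mem_linearWeyl hα)) α
    rw [reflection_self hα.2] at this
    have h2 := Submodule.smul_mem _ (-(1 / 2) : ℝ) this
    rwa [show (-(1 / 2) : ℝ) • (-α - α) = α by module] at h2
  have hne : S.Nonempty := by
    rw [Set.nonempty_iff_ne_empty]
    rintro rfl
    have := hspan hβ
    rw [Submodule.span_empty] at this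
    exact hβ.2 (by rw [(Submodule.mem_bot ℝ).1 this]; simp)
  have hsub := hS.withIsotropic_subset hB hR
  refine ⟨?_, ?_, ?_, ?_, ?_, ?_, ?_, ?_⟩
  · obtain ⟨α, hα⟩ := hne
    exact Or.inr ⟨by simp, α, hα, by simpa using hα⟩
  · have key : ∀ x ∈ withIsotropic B S, -x ∈ withIsotropic B S := by
      rintro x (hx | ⟨h0, α, hα, hαx⟩)
      · exact Or.inl (hS.neg_mem hx)
      · refine Or.inr ⟨by simpa using h0, -α, hS.neg_mem hα, ?_⟩
        rw [← neg_add]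
        exact hS.neg_mem hαx
    ext x
    exact ⟨fun h => neg_neg x ▸ key _ h, key x⟩
  · rw [← top_le_iff, ← hR.span_anisotropicPart hB, Submodule.span_le]
    exact hspan.trans (Submodule.span_mono Set.subset_union_left)
  · rw [hS.anisotropicPart_withIsotropic]
    exact fun α hα h => hR.two_smul_notMem α (hS.subset hα) (hsub h)
  · exact hR.discrete.mono hsub
  · rw [hS.anisotropicPart_withIsotropic]
    exact fun α hα x hx => hS.root_string hB hR hα hx
  · rw [hS.anisotropicPart_withIsotropic]
    rintro ⟨S₁, S₂, h1, h2, hdisj, hunion, horth⟩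
    -- On the orthogonal complement of `T₁`, reflections in `T₁` act trivially and those in `T₂`
    -- move vectors by multiples of vectors orthogonal to `T₁`.
    have hstab : ∀ T₁ T₂ : Set 𝒱, T₁ ∪ T₂ = S → (∀ α ∈ T₁, ∀ γ ∈ T₂, B α γ = 0) →
        ∀ γ ∈ S, ∀ v ∈ {v | ∀ α ∈ T₁, B v α = 0},
          reflection B γ v ∈ {v | ∀ α ∈ T₁, B v α = 0} := by
      intro T₁ T₂ hT horthT γ hγ v hv α hα
      rw [← hT] at hγ
      rcases hγ with hγ | hγ
      · rw [reflection_of_apply_eq_zero (hv γ hγ)]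
        exact hv α hα
      · rw [reflection_apply, map_sub, LinearMap.sub_apply, hv α hα, map_smul,
          LinearMap.smul_apply, hB.isSymm.eq γ α, horthT α hα γ hγ]
        simp
    -- If `β` is orthogonal to `T₁`, so is its orbit, and `T₁` splits off from all of `R^×`.
    have key : ∀ T₁ T₂ : Set 𝒱, T₁.Nonempty → T₂.Nonempty → T₁ ∪ T₂ = S →
        (∀ α ∈ T₁, ∀ γ ∈ T₂, B α γ = 0) → (∀ α ∈ T₁, B β α = 0) → False := by
      intro T₁ T₂ hT₁ hT₂ hT horthT hβT
      refine hR.irreducible ⟨T₁, anisotropicPart B R \ T₁, hT₁, ?_, Set.disjoint_sdiff_right, ?_, ?_⟩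
      · obtain ⟨γ, hγ⟩ := hT₂
        refine ⟨γ, hS.subset (hT ▸ Or.inr hγ), fun h => ?_⟩
        exact (hS.subset (hT ▸ Or.inr hγ)).2 (horthT γ h γ hγ)
      · exact Set.union_sdiff_cancel ((Set.subset_union_left.trans hT.subset).trans hS.subset)
      · intro α hα γ hγ
        rw [hB.isSymm.eq]
        by_cases hγS : γ ∈ S
        · rw [← hT] at hγS
          rw [hB.isSymm.eq]
          exact horthT α hα γ (hγS.resolve_left hγ.2)
        · obtain ⟨g, hg, rfl⟩ := horb γ hγ.1 hγS
          exact apply_mem_of_mem_linearWeyl (hstab T₁ T₂ hT horthT) (hgen hg) hβT α hα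
    by_cases hβ1 : ∀ α ∈ S₁, B β α = 0
    · exact key S₁ S₂ h1 h2 hunion horth hβ1
    · push Not at hβ1
      obtain ⟨α, hα, hβα⟩ := hβ1
      have hunion' : S₂ ∪ S₁ = S := by rw [Set.union_comm, hunion]
      have horth' : ∀ γ ∈ S₂, ∀ δ ∈ S₁, B γ δ = 0 := fun γ hγ δ hδ => by
        rw [hB.isSymm.eq]; exact horth δ hδ γ hγ
      refine key S₂ S₁ h2 h1 hunion' horth' ?_
      -- `r_β α` stays orthogonal to `S₂`, and `r_β α - α` is a nonzero multiple of `β`.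
      have := apply_mem_of_mem_linearWeyl (hstab S₂ S₁ hunion' horth')
        (hgen (reflection_mem_linearWeyl hβ)) (v := α) (horth α hα)
      intro δ hδ
      have h3 := this δ hδ
      rw [reflection_apply, map_sub, LinearMap.sub_apply, horth α hα δ hδ, map_smul,
        LinearMap.smul_apply, zero_sub, neg_eq_zero, smul_eq_mul] at h3
      refine (mul_eq_zero.1 h3).resolve_left ?_
      rw [hB.isSymm.eq α β]
      exact div_ne_zero (mul_ne_zero two_ne_zero hβα) hβ.2
  · rintro σ ⟨hσ | ⟨h0, α, hα, hασ⟩, h⟩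
    · exact absurd h (hS.subset hσ).2
    · rw [hS.anisotropicPart_withIsotropic]
      exact ⟨α, hα, Or.inl hασ⟩

end IsWeylStable

theorem isWeylStable_removeOrbit [TopologicalSpace 𝒱] {D : Submodule ℝ 𝒱}
    {hD : IsCompl (nullspace B) D} {R : Set 𝒱} (hB : B.IsPosSemidef) (hR : IsEARS B R) (β : 𝒱) :
    IsWeylStable B R (removeOrbit B D hD R β) := by
  refine ⟨fun α hα => hα.1, fun α hα x hx => ?_⟩
  rw [mem_removeOrbit] at hx ⊢
  refine ⟨hR.reflection_mem_anisotropicPart hB hα hx.1, fun g hg h => ?_⟩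
  refine hx.2 (reflection B α * g) (mul_mem (reflection_mem_linearWeyl hα) hg) ?_
  rw [LinearEquiv.mul_apply, h, reflection_reflection]

/-! ### Finiteness of the quotient root system -/

theorem cartan_mem_Icc (hB : B.IsPosSemidef) {x y : 𝒱} (hx : B x x ≠ 0) (hy : B y y ≠ 0) {m n : ℤ}
    (hm : 2 * B x y = m * B y y) (hn : 2 * B y x = n * B x x) : m ∈ Set.Icc (-4 : ℤ) 4 := by
  have h := cartan_mul_le hB hx hy hm hn
  have hxp := apply_self_pos hB hx
  have hyp := apply_self_pos hB hy
  rw [hB.isSymm.eq y x] at hn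
  rcases lt_trichotomy (B x y) 0 with h0 | h0 | h0
  · have hm0 : m < 0 := by
      have : (m : ℝ) < 0 := by by_contra! h'; nlinarith
      exact_mod_cast this
    have hn0 : n < 0 := by
      have : (n : ℝ) < 0 := by by_contra! h'; nlinarith
      exact_mod_cast this
    constructor <;> nlinarith
  · have hm0 : m = 0 := by
      have : (m : ℝ) = 0 := by
        rw [h0, mul_zero] at hm
        exact (mul_eq_zero.1 hm.symm).resolve_right hy
      exact_mod_cast this
    simp [hm0]
  · have hm0 : 0 < m := by
      have : 0 < (m : ℝ) := by by_contra! h'; nlinarith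
      exact_mod_cast this
    have hn0 : 0 < n := by
      have : 0 < (n : ℝ) := by by_contra! h'; nlinarith
      exact_mod_cast this
    constructor <;> nlinarith

/-- A functional `B α` is determined by its values on a basis of roots `y`, and each value is `(y,
y) / 2` times a Cartan integer in `[-4, 4]`. -/
theorem IsEARS.finite_image_anisotropicPart [FiniteDimensional ℝ 𝒱] [TopologicalSpace 𝒱]
    {R : Set 𝒱} (hB : B.IsPosSemidef) (hR : IsEARS B R) : (B '' anisotropicPart B R).Finite := by
  obtain ⟨Y, hYR, hYspan, hYli⟩ := exists_linearIndependent ℝ (anisotropicPart B R)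
  rw [hR.span_anisotropicPart hB] at hYspan
  have : Finite Y := hYli.finite
  let F : Y → Set ℝ := fun y => (fun n : ℤ => (n * B y y / 2 : ℝ)) '' Set.Icc (-4) 4
  have hF : (Set.univ.pi F).Finite := Set.Finite.pi fun y => (Set.finite_Icc _ _).image _
  refine Set.Finite.of_finite_image (f := fun (φ : Module.Dual ℝ 𝒱) (y : Y) => φ y)
    (hF.subset ?_) ?_
  · rintro _ ⟨_, ⟨α, hα, rfl⟩, rfl⟩ y -
    obtain ⟨m, hm, -⟩ := hR.exists_cartan hB (hYR y.2) hα.1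
    obtain ⟨n, hn, -⟩ := hR.exists_cartan hB hα (hYR y.2).1
    exact ⟨m, cartan_mem_Icc hB hα.2 (hYR y.2).2 hm hn, by simp only; linarith⟩
  · intro φ _ ψ _ h
    exact LinearMap.ext_on hYspan fun y hy => congrFun h ⟨y, hy⟩

/-! ### A parity argument -/

/-- A linear automorphism that permutes a finite set of functionals up to signs multiplies their
product by a constant. -/
theorem exists_prod_comp_eq (P : Finset (Module.Dual ℝ 𝒱)) {x₀ : 𝒱} (hpos : ∀ φ ∈ P, 0 < φ x₀)
    (g : 𝒱 ≃ₗ[ℝ] 𝒱) (hg : ∀ φ ∈ P, ∃ ψ ∈ P, φ ∘ₗ g.toLinearMap = ψ ∨ φ ∘ₗ g.toLinearMap = -ψ) :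
    ∃ c : ℝ, ∀ v, ∏ φ ∈ P, φ (g v) = c * ∏ φ ∈ P, φ v := by
  classical
  have h : ∀ φ, ∃ ψ : Module.Dual ℝ 𝒱, ∃ ε : ℝ, φ ∈ P →
      ψ ∈ P ∧ (ε = 1 ∨ ε = -1) ∧ ∀ v, φ (g v) = ε * ψ v := by
    intro φ
    by_cases hφ : φ ∈ P
    · obtain ⟨ψ, hψ, h | h⟩ := hg φ hφ
      · exact ⟨ψ, 1, fun _ => ⟨hψ, Or.inl rfl, fun v => by
          simpa using LinearMap.congr_fun h v⟩⟩
      · exact ⟨ψ, -1, fun _ => ⟨hψ, Or.inr rfl, fun v => by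
          simpa using LinearMap.congr_fun h v⟩⟩
    · exact ⟨0, 0, fun h => absurd h hφ⟩
  choose t ε ht using h
  -- Functionals with the same image agree up to sign, and positivity at `x₀` excludes the minus
  -- sign.
  have hinj : Set.InjOn t P := by
    intro φ hφ ψ hψ h
    obtain ⟨-, h1, h2⟩ := ht φ hφ
    obtain ⟨-, h3, h4⟩ := ht ψ hψ
    have h5 : ∀ v, ε ψ * φ v = ε φ * ψ v := by
      intro v
      have e1 := h2 (g.symm v)
      have e2 := h4 (g.symm v)
      rw [g.apply_symm_apply] at e1 e2
      rw [e1, e2, h]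
      ring
    have h6 := h5 x₀
    have p1 := hpos φ hφ
    have p2 := hpos ψ hψ
    ext v
    have h7 := h5 v
    rcases h1 with h1 | h1 <;> rcases h3 with h3 | h3 <;> rw [h1, h3] at h6 h7 <;> linarith
  have himg : P.image t = P :=
    Finset.eq_of_subset_of_card_le (Finset.image_subset_iff.2 fun φ hφ => (ht φ hφ).1)
      (Finset.card_image_of_injOn hinj).ge
  refine ⟨∏ φ ∈ P, ε φ, fun v => ?_⟩
  rw [Finset.prod_congr rfl fun φ hφ => (ht φ hφ).2.2 v, Finset.prod_mul_distrib]
  congr 1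
  conv_rhs => rw [← himg]
  rw [Finset.prod_image hinj]

/-- The component of `δ` orthogonal to `α` works: its pairing with `δ` is the Cauchy–Schwarz defect
divided by `(α, α)`. -/
theorem exists_apply_eq_zero_of_sq_lt (hB : B.IsPosSemidef) {α δ : 𝒱} (hα : B α α ≠ 0)
    (h : B α δ ^ 2 < B α α * B δ δ) : ∃ v ∈ LinearMap.ker (B α), B δ v ≠ 0 := by
  refine ⟨δ - (B α δ / B α α) • α, ?_, ?_⟩
  · rw [LinearMap.mem_ker, map_sub, map_smul, smul_eq_mul, div_mul_cancel₀ _ hα, sub_self]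
  · rw [map_sub, map_smul, smul_eq_mul, hB.isSymm.eq δ α, div_mul_eq_mul_div, ← sq]
    have := apply_self_pos hB hα
    rw [← mul_comm] at h
    exact (sub_pos.2 ((div_lt_iff₀ this).2 h)).ne'

/-- The constant is read off at a fixed point of the reflection. No factor vanishes on the whole
mirror of `α`, and finitely many proper subspaces do not cover it, so some point there has nonzero
product. -/
theorem prod_reflection_eq (hB : B.IsPosSemidef) {P : Finset (Module.Dual ℝ 𝒱)} {x₀ α : 𝒱}
    (hpos : ∀ φ ∈ P, 0 < φ x₀) (hα : B α α ≠ 0)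
    (hg : ∀ φ ∈ P, ∃ ψ ∈ P, φ ∘ₗ (reflection B α).toLinearMap = ψ ∨
      φ ∘ₗ (reflection B α).toLinearMap = -ψ)
    (hP : ∀ φ ∈ P, ∃ δ, φ = B δ ∧ B α δ ^ 2 < B α α * B δ δ) (v : 𝒱) :
    ∏ φ ∈ P, φ (reflection B α v) = ∏ φ ∈ P, φ v := by
  obtain ⟨c, hc⟩ := exists_prod_comp_eq P hpos (reflection B α) hg
  obtain ⟨w, hw, hw'⟩ := Module.Dual.exists_forall_mem_ne_zero_of_forall_exists
    (LinearMap.ker (B α)) (fun φ : P => φ.1) (fun φ => by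
      obtain ⟨δ, h1, h2⟩ := hP φ.1 φ.2
      rw [h1]
      exact exists_apply_eq_zero_of_sq_lt hB hα h2)
  have h := hc w
  rw [reflection_of_apply_eq_zero (by rw [hB.isSymm.eq]; exact hw)] at h
  have h0 : ∏ φ ∈ P, φ w ≠ 0 := Finset.prod_ne_zero_iff.2 fun φ hφ => hw' ⟨φ, hφ⟩
  have hc1 : c = 1 := by
    have := mul_right_cancel₀ h0 ((one_mul _).trans h)
    exact this.symm
  rw [hc, hc1, one_mul]

theorem comp_reflection (hB : B.IsPosSemidef) (α δ : 𝒱) :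
    B δ ∘ₗ (reflection B α).toLinearMap = B (reflection B α δ) := by
  ext v
  have := apply_reflection_reflection hB α (reflection B α δ) v
  rw [reflection_reflection] at this
  simpa using this

/-- Equality in Cauchy–Schwarz at equal lengths makes `δ - β` or `δ + β` isotropic, hence radical.
-/
theorem apply_eq_or_eq_neg (hB : B.IsPosSemidef) {β δ : 𝒱} (h : B δ δ = B β β)
    (hs : B β δ ^ 2 = B β β * B δ δ) : B δ = B β ∨ B δ = -B β := by
  rw [h, ← sq, sq_eq_sq_iff_eq_or_eq_neg] at hs
  rcases hs with hs | hs
  · left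
    rw [← sub_eq_zero, ← map_sub]
    refine apply_eq_zero_of_isotropic hB ?_
    simp only [map_sub, LinearMap.sub_apply, hB.isSymm.eq δ β]
    linarith
  · right
    rw [← sub_eq_zero, sub_neg_eq_add, ← map_add]
    refine apply_eq_zero_of_isotropic hB ?_
    simp only [map_add, LinearMap.add_apply, hB.isSymm.eq δ β]
    linarith

/-- A reflection `r_β` in the group generated by the reflections in a Weyl stable set `S` is the
reflection in a root proportional to a root in `S` (modulo isotropic vectors). -/
theorem IsWeylStable.exists_proportional [FiniteDimensional ℝ 𝒱] [TopologicalSpace 𝒱]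
    {R S : Set 𝒱} (hB : B.IsPosSemidef) (hR : IsEARS B R) (hS : IsWeylStable B R S) {β : 𝒱}
    (hβ : β ∈ anisotropicPart B R) (hβS : reflection B β ∈ linearWeyl B S) :
    ∃ α ∈ S, B α β ^ 2 = B α α * B β β := by
  classical
  by_contra! hcon
  let W := linearWeyl B (anisotropicPart B R)
  let O : Set 𝒱 := {δ | ∃ g ∈ W, g β = δ}
  have hOR : O ⊆ anisotropicPart B R := by
    rintro _ ⟨g, hg, rfl⟩
    exact apply_mem_of_mem_linearWeyl (fun α hα v hv =>
      hR.reflection_mem_anisotropicPart hB hα hv) hg hβ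
  have hOlen : ∀ δ ∈ O, B δ δ = B β β := by
    rintro _ ⟨g, hg, rfl⟩
    exact apply_of_mem_linearWeyl hB hg β β
  have hOrefl : ∀ α ∈ anisotropicPart B R, ∀ δ ∈ O, reflection B α δ ∈ O := by
    rintro α hα _ ⟨g, hg, rfl⟩
    exact ⟨reflection B α * g, mul_mem (reflection_mem_linearWeyl hα) hg, rfl⟩
  -- Invariance of `S` and of the form carries strictness from `β` to its whole orbit.
  have hOlt : ∀ α ∈ S, ∀ δ ∈ O, B α δ ^ 2 < B α α * B δ δ := by
    rintro α hα _ ⟨g, hg, rfl⟩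
    refine lt_of_le_of_ne (apply_sq_le hB _ _) ?_
    have h1 : g⁻¹ α ∈ S := apply_mem_of_mem_linearWeyl hS.reflection_mem (inv_mem hg) hα
    have h2 := apply_of_mem_linearWeyl hB (inv_mem hg) α (g β)
    have h3 := apply_of_mem_linearWeyl hB (inv_mem hg) α α
    have h4 : g⁻¹ (g β) = β := g.symm_apply_apply β
    rw [h4] at h2
    rw [apply_of_mem_linearWeyl hB hg, ← h2, ← h3]
    exact hcon _ h1
  have hfin : (B '' O).Finite := (hR.finite_image_anisotropicPart hB).subset (Set.image_mono hOR)
  have := hfin.to_subtype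
  -- A generic point, whose sign selects one functional from each pair `±B δ`.
  obtain ⟨x₀, hx₀⟩ := Module.Dual.exists_forall_ne_zero_of_forall_exists
    (fun φ : B '' O => φ.1) (by
      rintro ⟨_, δ, hδ, rfl⟩
      exact ⟨δ, (hOR hδ).2⟩)
  let P : Finset (Module.Dual ℝ 𝒱) := hfin.toFinset.filter fun φ => 0 < φ x₀
  have hPmem : ∀ φ, φ ∈ P ↔ φ ∈ B '' O ∧ 0 < φ x₀ := fun φ => by simp [P]
  have hpos : ∀ φ ∈ P, 0 < φ x₀ := fun φ hφ => ((hPmem φ).1 hφ).2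
  have hOP : ∀ δ ∈ O, ∃ ψ ∈ P, B δ = ψ ∨ B δ = -ψ := by
    intro δ hδ
    have h0 : B δ x₀ ≠ 0 := hx₀ ⟨_, δ, hδ, rfl⟩
    rcases lt_or_gt_of_ne h0 with h0 | h0
    · refine ⟨B (-δ), (hPmem _).2 ⟨⟨-δ, ?_, rfl⟩, by simpa using h0⟩, Or.inr (by simp)⟩
      rw [← reflection_self (hOR hδ).2]
      exact hOrefl δ (hOR hδ) δ hδ
    · exact ⟨B δ, (hPmem _).2 ⟨⟨δ, hδ, rfl⟩, h0⟩, Or.inl rfl⟩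
  have hPrefl : ∀ α ∈ anisotropicPart B R, ∀ φ ∈ P, ∃ ψ ∈ P,
      φ ∘ₗ (reflection B α).toLinearMap = ψ ∨ φ ∘ₗ (reflection B α).toLinearMap = -ψ := by
    intro α hα φ hφ
    obtain ⟨⟨δ, hδ, rfl⟩, -⟩ := (hPmem φ).1 hφ
    rw [comp_reflection hB]
    exact hOP _ (hOrefl α hα δ hδ)
  have hinv : ∀ v, ∏ φ ∈ P, φ (reflection B β v) = ∏ φ ∈ P, φ v := by
    refine Subgroup.closure_induction
      (p := fun g _ => ∀ v, ∏ φ ∈ P, φ (g v) = ∏ φ ∈ P, φ v) ?_ ?_ ?_ ?_ hβS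
    · rintro _ ⟨α, hα, rfl⟩ v
      refine prod_reflection_eq hB hpos (hS.subset hα).2 (hPrefl α (hS.subset hα)) ?_ v
      intro φ hφ
      obtain ⟨⟨δ, hδ, rfl⟩, -⟩ := (hPmem φ).1 hφ
      exact ⟨δ, rfl, hOlt α hα δ hδ⟩
    · exact fun v => rfl
    · intro x y _ _ hx hy v
      rw [← hy v, ← hx (y v), LinearEquiv.mul_apply]
    · intro x _ hx v
      rw [← hx, LinearEquiv.coe_inv, LinearEquiv.apply_symm_apply]
  obtain ⟨φβ, hφβ, hφβ'⟩ := hOP β ⟨1, one_mem _, rfl⟩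
  have hφβr : ∀ v, φβ (reflection B β v) = -φβ v := by
    intro v
    have h1 := LinearMap.congr_fun (comp_reflection hB β β) v
    rw [reflection_self hβ.2] at h1
    rcases hφβ' with h | h
    · rw [← h]
      simpa using h1
    · rw [← neg_eq_iff_eq_neg] at h
      have h2 : B β (reflection B β v) = -B β v := by simpa using h1
      rw [← h, LinearMap.neg_apply, LinearMap.neg_apply, h2]
  have hsplit : ∀ v, ∏ φ ∈ P, φ v = φβ v * ∏ φ ∈ P.erase φβ, φ v :=
    fun v => (Finset.mul_prod_erase P (fun φ => φ v) hφβ).symm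
  -- All orbit members have the length of `β`, so no remaining factor is proportional to `φβ`, and
  -- the mirror argument applies to `β` itself.
  have hP' : ∀ v, ∏ φ ∈ P.erase φβ, φ (reflection B β v) = ∏ φ ∈ P.erase φβ, φ v := by
    refine prod_reflection_eq hB (x₀ := x₀) (fun φ hφ => hpos φ (Finset.mem_of_mem_erase hφ))
      hβ.2 ?_ ?_
    · intro φ hφ
      obtain ⟨ψ, hψ, h⟩ := hPrefl β hβ φ (Finset.mem_of_mem_erase hφ)
      refine ⟨ψ, Finset.mem_erase.2 ⟨?_, hψ⟩, h⟩
      rintro rfl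
      have key : ∀ ε : ℝ, (∀ v, φ (reflection B β v) = ε * ψ v) → ∀ v, φ v = -ε * ψ v := by
        intro ε hε v
        have := hε (reflection B β v)
        rw [reflection_reflection, hφβr] at this
        rw [this]
        ring
      have p1 := hpos φ (Finset.mem_of_mem_erase hφ)
      have p2 := hpos ψ hψ
      rcases h with h | h
      · have := key 1 (fun v => by simpa using LinearMap.congr_fun h v) x₀
        linarith
      · refine Finset.ne_of_mem_erase hφ (LinearMap.ext fun v => ?_)
        have := key (-1) (fun v => by simpa using LinearMap.congr_fun h v) v
        linarith
    · intro φ hφ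
      obtain ⟨⟨δ, hδ, rfl⟩, -⟩ := (hPmem φ).1 (Finset.mem_of_mem_erase hφ)
      refine ⟨δ, rfl, lt_of_le_of_ne (apply_sq_le hB _ _) fun h => ?_⟩
      refine Finset.ne_of_mem_erase hφ (LinearMap.ext fun v => ?_)
      have p1 := hpos _ (Finset.mem_of_mem_erase hφ)
      have p2 := hpos φβ hφβ
      rcases apply_eq_or_eq_neg hB (hOlen δ hδ) h with h | h <;> rcases hφβ' with h' | h' <;>
        rw [h, h'] at p1 ⊢ <;> simp at p1 ⊢ <;> linarith
  have h1 := hinv x₀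
  rw [hsplit, hsplit x₀, hφβr, hP'] at h1
  have h2 : 0 < φβ x₀ * ∏ φ ∈ P.erase φβ, φ x₀ := by
    rw [← hsplit]
    exact Finset.prod_pos hpos
  linarith

end EARS

namespace EARS

/-! ### Non-reduced irreducible root systems -/

variable {E : Type*} [AddCommGroup E] [Module ℝ E]

/-- Irreducible root systems, with respect to a given invariant positive definite form. -/
structure IsRootSet (b : LinearMap.BilinForm ℝ E) (Φ : Set E) : Prop where
  posSemidef : b.IsPosSemidef
  definite : ∀ x, b x x = 0 → x = 0
  zero_notMem : (0 : E) ∉ Φ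
  span_eq_top : Submodule.span ℝ Φ = ⊤
  reflection_mem : ∀ x ∈ Φ, ∀ y ∈ Φ, reflection b x y ∈ Φ
  exists_cartan : ∀ x ∈ Φ, ∀ y ∈ Φ, ∃ n : ℤ, 2 * b x y = n * b y y
  irreducible : ∀ Φ₁ ⊆ Φ, Φ₁.Nonempty → (∀ x ∈ Φ₁, ∀ y ∈ Φ, y ∉ Φ₁ → b x y = 0) → Φ₁ = Φ

/-- The roots `x` of the same length as `a` such that `2x` is a root. -/
def shortRoots (b : LinearMap.BilinForm ℝ E) (Φ : Set E) (a : E) : Set E :=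
  {x ∈ Φ | (2 : ℝ) • x ∈ Φ ∧ b x x = b a a}

namespace IsRootSet

variable {b : LinearMap.BilinForm ℝ E} {Φ : Set E} {a x y z : E}

theorem apply_self_ne_zero (h : IsRootSet b Φ) (hx : x ∈ Φ) : b x x ≠ 0 :=
  fun h0 => h.zero_notMem (h.definite x h0 ▸ hx)

theorem apply_self_pos (h : IsRootSet b Φ) (hx : x ∈ Φ) : 0 < b x x :=
  EARS.apply_self_pos h.posSemidef (h.apply_self_ne_zero hx)

theorem comm (h : IsRootSet b Φ) (x y : E) : b x y = b y x := h.posSemidef.isSymm.eq x y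

theorem neg_mem (h : IsRootSet b Φ) (hx : x ∈ Φ) : -x ∈ Φ :=
  reflection_self (h.apply_self_ne_zero hx) ▸ h.reflection_mem x hx x hx

theorem eq_smul (h : IsRootSet b Φ) {t : ℝ} (h1 : b y x = t * b x x)
    (h2 : b y y = t ^ 2 * b x x) : y = t • x := by
  rw [← sub_eq_zero]
  refine h.definite _ ?_
  simp only [map_sub, LinearMap.sub_apply, map_smul, LinearMap.smul_apply, smul_eq_mul, h.comm x y]
  rw [h1, h2]
  ring

theorem neg_mem_shortRoots (h : IsRootSet b Φ) (hx : x ∈ shortRoots b Φ a) :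
    -x ∈ shortRoots b Φ a :=
  ⟨h.neg_mem hx.1, by rw [smul_neg]; exact h.neg_mem hx.2.1, by simpa using hx.2.2⟩

theorem reflection_mem_shortRoots (h : IsRootSet b Φ) (hy : y ∈ Φ) (hx : x ∈ shortRoots b Φ a) :
    reflection b y x ∈ shortRoots b Φ a := by
  refine ⟨h.reflection_mem y hy x hx.1, ?_, ?_⟩
  · rw [← map_smul]
    exact h.reflection_mem y hy _ hx.2.1
  · rw [apply_reflection_reflection h.posSemidef, hx.2.2]

/-- The position of a root relative to a root `x` such that `2x` is a root. -/
theorem eq_or_apply_eq (h : IsRootSet b Φ) (hx : x ∈ Φ) (hx2 : (2 : ℝ) • x ∈ Φ) (hy : y ∈ Φ)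
    (hyx : b y x ≠ 0) : (y = x ∨ y = -x) ∨ (y = (2 : ℝ) • x ∨ y = -(2 : ℝ) • x) ∨
      b y y = 2 * b x x ∧ (b y x = b x x ∨ b y x = -b x x) := by
  -- Integrality against `2x` makes the Cartan number of `y` along `x` even, `2n`; hence `n * k ≤
  -- 2`, and few cases remain.
  obtain ⟨n, hn⟩ := h.exists_cartan y hy _ hx2
  obtain ⟨k, hk⟩ := h.exists_cartan x hx y hy
  simp only [map_smul, LinearMap.smul_apply, smul_eq_mul] at hn
  have hn1 : b y x = n * b x x := by linarith
  have hxp := h.apply_self_pos hx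
  have hyp := h.apply_self_pos hy
  have hle := cartan_mul_le h.posSemidef (h.apply_self_ne_zero hy) (h.apply_self_ne_zero hx)
    (m := 2 * n) (by push_cast; linarith) hk
  rw [h.comm x y] at hk
  have hn0 : n ≠ 0 := by rintro rfl; simp [hn1] at hyx
  have hpos : 0 < n * k := by
    have h1 : (n * k : ℝ) * (b x x * b y y) = 2 * b y x ^ 2 := by
      linear_combination (-(k : ℝ) * b y y) * hn1 - b y x * hk
    have h2 : (0 : ℝ) < n * k := by
      have : 0 < b y x ^ 2 := by positivity
      by_contra! h3
      nlinarith [mul_pos hxp hyp]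
    exact_mod_cast h2
  have hle2 : n * k ≤ 2 := by linarith
  have hcases : (n = 1 ∧ k = 1) ∨ (n = -1 ∧ k = -1) ∨ (n = 1 ∧ k = 2) ∨ (n = -1 ∧ k = -2) ∨
      (n = 2 ∧ k = 1) ∨ (n = -2 ∧ k = -1) := by
    have hk0 : k ≠ 0 := by rintro rfl; simp at hpos
    rcases lt_or_gt_of_ne hn0 with h1 | h1
    · have h2 : k < 0 := by by_contra!; nlinarith
      have h3 : -2 ≤ n := by nlinarith
      have h4 : -2 ≤ k := by nlinarith
      interval_cases n <;> interval_cases k <;> simp at *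
    · have h2 : 0 < k := by by_contra!; nlinarith
      have h3 : n ≤ 2 := by nlinarith
      have h4 : k ≤ 2 := by nlinarith
      interval_cases n <;> interval_cases k <;> simp at *
  rcases hcases with ⟨rfl, rfl⟩ | ⟨rfl, rfl⟩ | ⟨rfl, rfl⟩ | ⟨rfl, rfl⟩ | ⟨rfl, rfl⟩ | ⟨rfl, rfl⟩ <;>
    push_cast at hn1 hk
  · exact Or.inr (Or.inr ⟨by linarith, Or.inl (by linarith)⟩)
  · exact Or.inr (Or.inr ⟨by linarith, Or.inr (by linarith)⟩)
  · refine Or.inl (Or.inl ?_)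
    simpa using h.eq_smul (t := 1) hn1 (by linarith)
  · refine Or.inl (Or.inr ?_)
    simpa using h.eq_smul (t := -1) hn1 (by linarith)
  · exact Or.inr (Or.inl (Or.inl (h.eq_smul hn1 (by linarith))))
  · exact Or.inr (Or.inl (Or.inr (h.eq_smul hn1 (by linarith))))

theorem eq_or_eq_neg_or_apply_eq_zero (h : IsRootSet b Φ) (hx : x ∈ shortRoots b Φ a)
    (hy : y ∈ shortRoots b Φ a) : (y = x ∨ y = -x) ∨ b y x = 0 := by
  by_cases h0 : b y x = 0
  · exact Or.inr h0
  left
  have hxp := h.apply_self_pos hx.1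
  have hxy : b y y = b x x := hy.2.2.trans hx.2.2.symm
  rcases h.eq_or_apply_eq hx.1 hx.2.1 hy.1 h0 with h1 | (h1 | h1) | h1
  · exact h1
  · rw [h1] at hxy
    simp at hxy
    linarith
  · rw [h1] at hxy
    simp at hxy
    linarith
  · linarith [h1.1]

theorem sub_mem_shortRoots (h : IsRootSet b Φ) (hx : x ∈ shortRoots b Φ a) (hy : y ∈ Φ)
    (hyx : b y x = b x x) (hyy : b y y = 2 * b x x) : y - x ∈ shortRoots b Φ a := by
  have := h.neg_mem_shortRoots (h.reflection_mem_shortRoots hy hx)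
  rw [reflection_of_two_mul_eq (n := 1) (h.apply_self_ne_zero hy)
    (by rw [h.comm x y, hyx, hyy]; simp)] at this
  simpa using this

/-- Every root that is not orthogonal to a short root `x` is `± x`, `± 2x` or the sum of two
orthogonal short roots, one of which is `± x`. -/
theorem eq_or_eq_add (h : IsRootSet b Φ) (hx : x ∈ shortRoots b Φ a) (hy : y ∈ Φ)
    (hyx : b y x ≠ 0) : (y = x ∨ y = -x) ∨ (y = (2 : ℝ) • x ∨ y = -(2 : ℝ) • x) ∨
      ∃ x' ∈ shortRoots b Φ a, b x' x = 0 ∧ (y = x + x' ∨ y = -x + x') := by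
  rcases h.eq_or_apply_eq hx.1 hx.2.1 hy hyx with h1 | h1 | ⟨h1, h2 | h2⟩
  · exact Or.inl h1
  · exact Or.inr (Or.inl h1)
  · refine Or.inr (Or.inr ⟨y - x, h.sub_mem_shortRoots hx hy h2 h1, ?_, Or.inl (by abel)⟩)
    simp [h2]
  · refine Or.inr (Or.inr ⟨y - -x, h.sub_mem_shortRoots (h.neg_mem_shortRoots hx) hy
      (by simp [h2]) (by simpa using h1), ?_, Or.inr (by abel)⟩)
    simp [h2]

/-- A root not orthogonal to all short roots is a combination of short roots by `eq_or_eq_add`,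
hence orthogonal to every root that is orthogonal to them all. Irreducibility rules out roots of the
latter kind. -/
theorem exists_apply_ne_zero (h : IsRootSet b Φ) (ha : a ∈ Φ) (ha2 : (2 : ℝ) • a ∈ Φ)
    (hz : z ∈ Φ) : ∃ x ∈ shortRoots b Φ a, b z x ≠ 0 := by
  have haX : a ∈ shortRoots b Φ a := ⟨ha, ha2, rfl⟩
  have key := h.irreducible {z ∈ Φ | ∃ x ∈ shortRoots b Φ a, b z x ≠ 0} (fun z hz => hz.1)
    ⟨a, ha, a, haX, h.apply_self_ne_zero ha⟩ ?_
  · rw [← key] at hz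
    exact hz.2
  · rintro z ⟨hz, x, hx, hzx⟩ w hw hw'
    have hwX : ∀ x ∈ shortRoots b Φ a, b x w = 0 := by
      intro x hx
      by_contra h0
      exact hw' ⟨hw, x, hx, by rwa [h.comm]⟩
    rcases h.eq_or_eq_add hx hz hzx with (h1 | h1) | (h1 | h1) | ⟨x', hx', -, h1 | h1⟩ <;>
      rw [h1] <;> simp [hwX x hx]
    all_goals exact hwX x' hx'

theorem mem_span_shortRoots (h : IsRootSet b Φ) (ha : a ∈ Φ) (ha2 : (2 : ℝ) • a ∈ Φ)
    (hz : z ∈ Φ) : z ∈ Submodule.span ℝ (shortRoots b Φ a) := by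
  obtain ⟨x, hx, hzx⟩ := h.exists_apply_ne_zero ha ha2 hz
  have hxs := Submodule.subset_span (R := ℝ) hx
  rcases h.eq_or_eq_add hx hz hzx with (rfl | rfl) | (rfl | rfl) | ⟨x', hx', -, rfl | rfl⟩
  · exact hxs
  · exact Submodule.neg_mem _ hxs
  · exact Submodule.smul_mem _ _ hxs
  · exact Submodule.smul_mem _ _ hxs
  · exact add_mem hxs (Submodule.subset_span hx')
  · exact add_mem (Submodule.neg_mem _ hxs) (Submodule.subset_span hx')

/-- Short roots are pairwise equal up to sign or orthogonal. A maximal independent set of them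
spans, so a short root outside it up to sign would be orthogonal to everything. -/
theorem exists_basis [FiniteDimensional ℝ E] (h : IsRootSet b Φ) (ha : a ∈ Φ)
    (ha2 : (2 : ℝ) • a ∈ Φ) : ∃ (l : ℕ) (e : Module.Basis (Fin l) ℝ E),
      (∀ i, e i ∈ shortRoots b Φ a) ∧ (∀ i j, i ≠ j → b (e i) (e j) = 0) ∧
      ∀ x ∈ shortRoots b Φ a, ∃ i, x = e i ∨ x = -e i := by
  obtain ⟨Y, hYX, hYspan, hYli⟩ := exists_linearIndependent ℝ (shortRoots b Φ a)
  have hfin : Finite Y := hYli.finite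
  have := Fintype.ofFinite Y
  have htop : Submodule.span ℝ Y = ⊤ := by
    rw [hYspan, ← top_le_iff, ← h.span_eq_top, Submodule.span_le]
    exact fun z hz => h.mem_span_shortRoots ha ha2 hz
  let e₀ : Module.Basis Y ℝ E := Module.Basis.mk hYli (by simp [htop])
  let e := e₀.reindex (Fintype.equivFin Y)
  have he : ∀ i, e i = ((Fintype.equivFin Y).symm i : E) := by simp [e, e₀]
  refine ⟨Fintype.card Y, e, fun i => by rw [he]; exact hYX (Subtype.coe_prop _), ?_, ?_⟩
  · intro i j hij
    have hi : e i ∈ shortRoots b Φ a := by rw [he]; exact hYX (Subtype.coe_prop _)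
    have hj : e j ∈ shortRoots b Φ a := by rw [he]; exact hYX (Subtype.coe_prop _)
    refine (h.eq_or_eq_neg_or_apply_eq_zero hj hi).resolve_left ?_
    rintro (h1 | h1)
    · exact hij (e.injective h1)
    · have h2 := congrArg (fun v => e.repr v i) h1
      simp [hij.symm] at h2
  · intro x hx
    by_contra! hcon
    have hxY : ∀ y ∈ Y, b x y = 0 := by
      intro y hy
      refine (h.eq_or_eq_neg_or_apply_eq_zero (hYX hy) hx).resolve_left ?_
      have h1 := hcon (Fintype.equivFin Y ⟨y, hy⟩)
      rw [he, Equiv.symm_apply_apply] at h1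
      exact not_or.2 h1
    have : b x = 0 := LinearMap.ext_on htop fun y hy => hxY y hy
    exact h.apply_self_ne_zero hx.1 (by rw [this, LinearMap.zero_apply])

variable {l : ℕ} {e : Module.Basis (Fin l) ℝ E}

theorem exists_eq_of_mem (h : IsRootSet b Φ) (ha : a ∈ Φ) (ha2 : (2 : ℝ) • a ∈ Φ)
    (he : ∀ i, e i ∈ shortRoots b Φ a)
    (hX : ∀ x ∈ shortRoots b Φ a, ∃ i, x = e i ∨ x = -e i) (hz : z ∈ Φ) :
    (∃ i, z = e i ∨ z = -e i) ∨
      (∃ i j, i ≠ j ∧ (z = e i + e j ∨ z = e i - e j ∨ z = -e i - e j)) ∨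
      ∃ i, z = (2 : ℝ) • e i ∨ z = -(2 : ℝ) • e i := by
  obtain ⟨x, hx, hzx⟩ := h.exists_apply_ne_zero ha ha2 hz
  obtain ⟨i, hzi⟩ : ∃ i, b z (e i) ≠ 0 := by
    obtain ⟨i, rfl | rfl⟩ := hX x hx
    · exact ⟨i, hzx⟩
    · exact ⟨i, by simpa using hzx⟩
  rcases h.eq_or_eq_add (he i) hz hzi with h1 | h1 | ⟨x', hx', hx'i, h1⟩
  · exact Or.inl ⟨i, h1⟩
  · exact Or.inr (Or.inr ⟨i, h1⟩)
  · obtain ⟨j, hj⟩ := hX x' hx'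
    have hij : i ≠ j := by
      rintro rfl
      rcases hj with rfl | rfl
      · exact h.apply_self_ne_zero hx'.1 hx'i
      · exact h.apply_self_ne_zero (he i).1 (by simpa using hx'i)
    refine Or.inr (Or.inl ?_)
    rcases hj with rfl | rfl <;> rcases h1 with rfl | rfl
    · exact ⟨i, j, hij, Or.inl rfl⟩
    · exact ⟨j, i, hij.symm, Or.inr (Or.inl (by abel))⟩
    · exact ⟨i, j, hij, Or.inr (Or.inl (by abel))⟩
    · exact ⟨i, j, hij, Or.inr (Or.inr (by abel))⟩

theorem reflection_basis_eq (h : IsRootSet b Φ) (he : ∀ i, e i ∈ shortRoots b Φ a)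
    (horth : ∀ i j, i ≠ j → b (e i) (e j) = 0) {i j : Fin l} (hij : i ≠ j) :
    reflection b (e i - e j) (e j) = e i := by
  have hne : b (e i - e j) (e i - e j) ≠ 0 := fun h0 =>
    hij (e.injective (sub_eq_zero.1 (h.definite _ h0)))
  rw [reflection_of_two_mul_eq (n := -1) hne]
  · simp
  · simp only [map_sub, LinearMap.sub_apply, horth i j hij, horth j i hij.symm, (he i).2.2,
      (he j).2.2]
    push_cast
    ring

/-- Reflection in `e j` flips the sign of `e j` and fixes `e i`. -/
theorem add_mem_and_sub_mem (h : IsRootSet b Φ) (he : ∀ i, e i ∈ shortRoots b Φ a)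
    (horth : ∀ i j, i ≠ j → b (e i) (e j) = 0) {i j : Fin l} (hij : i ≠ j)
    (hz : e i + e j ∈ Φ ∨ e i - e j ∈ Φ ∨ -e i - e j ∈ Φ) :
    e i + e j ∈ Φ ∧ e i - e j ∈ Φ := by
  have hj : reflection b (e j) (e j) = -e j :=
    reflection_self (h.apply_self_ne_zero (he j).1)
  have hi : reflection b (e j) (e i) = e i := reflection_of_apply_eq_zero (horth i j hij)
  rcases hz with hz | hz | hz
  · have := h.reflection_mem _ (he j).1 _ hz
    rw [map_add, hi, hj, ← sub_eq_add_neg] at this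
    exact ⟨hz, this⟩
  · have := h.reflection_mem _ (he j).1 _ hz
    rw [map_sub, hi, hj, sub_neg_eq_add] at this
    exact ⟨this, hz⟩
  · have hz := h.neg_mem hz
    rw [neg_sub', neg_neg, sub_neg_eq_add] at hz
    have := h.reflection_mem _ (he j).1 _ hz
    rw [map_add, hi, hj, ← sub_eq_add_neg] at this
    exact ⟨hz, this⟩

/-- Call `k` linked to `i` if `k = i` or `e i + e k` is a root. Reflection in `e n - e m` carries `e
i + e m` to `e i + e n`, so linkage propagates along roots. The roots not orthogonal to some linked
`e k` thus form an orthogonal component, which must be everything. -/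
theorem add_mem (h : IsRootSet b Φ) (ha : a ∈ Φ) (ha2 : (2 : ℝ) • a ∈ Φ)
    (he : ∀ i, e i ∈ shortRoots b Φ a) (horth : ∀ i j, i ≠ j → b (e i) (e j) = 0)
    (hX : ∀ x ∈ shortRoots b Φ a, ∃ i, x = e i ∨ x = -e i) {i j : Fin l} (hij : i ≠ j) :
    e i + e j ∈ Φ := by
  have htrans : ∀ m n, m ≠ n → e m - e n ∈ Φ → m = i ∨ e i + e m ∈ Φ →
      n = i ∨ e i + e n ∈ Φ := by
    intro m n hmn hmem hm
    by_cases hni : n = i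
    · exact Or.inl hni
    right
    rcases hm with rfl | hm
    · exact (h.add_mem_and_sub_mem he horth hmn (Or.inr (Or.inl hmem))).1
    · have hnm : e n - e m ∈ Φ := by simpa using h.neg_mem hmem
      by_cases hmi : m = i
      · subst hmi
        exact (h.add_mem_and_sub_mem he horth hmn (Or.inr (Or.inl hmem))).1
      have h1 := h.reflection_mem _ hnm _ hm
      rwa [map_add, h.reflection_basis_eq he horth hmn.symm, reflection_of_apply_eq_zero] at h1
      rw [map_sub, horth i n (Ne.symm hni), horth i m (Ne.symm hmi), sub_zero]
  have key := h.irreducible {z ∈ Φ | ∃ k, (k = i ∨ e i + e k ∈ Φ) ∧ b z (e k) ≠ 0}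
    (fun z hz => hz.1) ⟨e i, (he i).1, i, Or.inl rfl, h.apply_self_ne_zero (he i).1⟩ ?_
  · have hj := (he j).1
    rw [← key] at hj
    obtain ⟨-, k, hk, hjk⟩ := hj
    obtain rfl : j = k := by
      by_contra hne
      exact hjk (horth j k hne)
    exact hk.resolve_left hij.symm
  · rintro z ⟨hz, k, hk, hzk⟩ w hw hw'
    have hwk : ∀ k, (k = i ∨ e i + e k ∈ Φ) → b (e k) w = 0 := by
      intro k hk
      by_contra h0
      exact hw' ⟨hw, k, hk, by rwa [h.comm]⟩
    have hkm : ∀ m, b (e m) (e k) ≠ 0 → m = k := fun m hm => by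
      by_contra hne
      exact hm (horth m k hne)
    rcases h.exists_eq_of_mem ha ha2 he hX hz with ⟨m, hm⟩ | ⟨m, n, hmn, hm⟩ | ⟨m, hm⟩
    · obtain rfl : m = k := hkm m (by rcases hm with rfl | rfl <;> simpa using hzk)
      rcases hm with rfl | rfl <;> simp [hwk m hk]
    · have hmem : e m - e n ∈ Φ := (h.add_mem_and_sub_mem he horth hmn (by
        rcases hm with rfl | rfl | rfl <;> simp [hz])).2
      have hmem' : e n - e m ∈ Φ := by simpa using h.neg_mem hmem
      have hor : m = k ∨ n = k := by
        by_contra! hne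
        apply hzk
        rcases hm with rfl | rfl | rfl <;> simp [horth m k hne.1, horth n k hne.2]
      have hmn' : b (e m) w = 0 ∧ b (e n) w = 0 := by
        rcases hor with rfl | rfl
        · exact ⟨hwk _ hk, hwk _ (htrans _ _ hmn hmem hk)⟩
        · exact ⟨hwk _ (htrans _ _ hmn.symm hmem' hk), hwk _ hk⟩
      rcases hm with rfl | rfl | rfl <;> simp [hmn'.1, hmn'.2]
    · obtain rfl : m = k := hkm m (by rcases hm with rfl | rfl <;> simpa using hzk)
      rcases hm with rfl | rfl <;> simp [hwk m hk]

end IsRootSet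

section coordinates

variable {l : ℕ} (e : Module.Basis (Fin l) ℝ E)

theorem equivFun_basis_eq_single (i : Fin l) : e.equivFun (e i) = Pi.single i 1 := by
  ext j
  simp [Module.Basis.equivFun_self, Pi.single_apply, eq_comm]

theorem equivFun_mem_unitRoots {z : E} :
    e.equivFun z ∈ unitRoots l ↔ ∃ i, z = e i ∨ z = -e i := by
  simp only [unitRoots, Set.mem_ofPred_eq, ← equivFun_basis_eq_single e, ← map_neg,
    EmbeddingLike.apply_eq_iff_eq]

theorem equivFun_mem_middleRoots {z : E} : e.equivFun z ∈ middleRoots l ↔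
    ∃ i j, i ≠ j ∧ (z = e i + e j ∨ z = e i - e j ∨ z = -e i - e j) := by
  simp only [middleRoots, Set.mem_ofPred_eq, ← equivFun_basis_eq_single e, ← map_neg, ← map_add,
    ← map_sub, EmbeddingLike.apply_eq_iff_eq]

theorem equivFun_mem_doubleRoots {z : E} :
    e.equivFun z ∈ doubleRoots l ↔ ∃ i, z = (2 : ℝ) • e i ∨ z = -(2 : ℝ) • e i := by
  have h2 : ∀ i : Fin l, (Pi.single i 2 : Fin l → ℝ) = e.equivFun ((2 : ℝ) • e i) := by
    intro i
    rw [map_smul, equivFun_basis_eq_single, ← Pi.single_smul, smul_eq_mul, mul_one]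
  simp only [doubleRoots, Set.mem_ofPred_eq, h2, ← map_neg, EmbeddingLike.apply_eq_iff_eq, neg_smul]

end coordinates

theorem IsRootSet.mem_iff {b : LinearMap.BilinForm ℝ E} {Φ : Set E} {a z : E}
    (h : IsRootSet b Φ) (ha : a ∈ Φ) (ha2 : (2 : ℝ) • a ∈ Φ) {l : ℕ}
    {e : Module.Basis (Fin l) ℝ E}
    (he : ∀ i, e i ∈ shortRoots b Φ a) (horth : ∀ i j, i ≠ j → b (e i) (e j) = 0)
    (hX : ∀ x ∈ shortRoots b Φ a, ∃ i, x = e i ∨ x = -e i) :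
    z ∈ Φ ↔ e.equivFun z ∈ rootsBC l := by
  rw [rootsBC, Set.mem_union, Set.mem_union, equivFun_mem_unitRoots, equivFun_mem_middleRoots,
    equivFun_mem_doubleRoots, or_assoc]
  refine ⟨h.exists_eq_of_mem ha ha2 he hX, ?_⟩
  rintro (⟨i, rfl | rfl⟩ | ⟨i, j, hij, hz⟩ | ⟨i, rfl | rfl⟩)
  · exact (he i).1
  · exact h.neg_mem (he i).1
  · have h1 := h.add_mem_and_sub_mem he horth hij (Or.inl (h.add_mem ha ha2 he horth hX hij))
    rcases hz with rfl | rfl | rfl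
    · exact h1.1
    · exact h1.2
    · rw [← neg_add']
      exact h.neg_mem h1.1
  · exact (he i).2.1
  · rw [neg_smul]
    exact h.neg_mem (he i).2.1

/-! ### Isomorphisms of root systems -/

theorem RootIso.trans {E F G : Type*} [AddCommGroup E] [Module ℝ E] [AddCommGroup F] [Module ℝ F]
    [AddCommGroup G] [Module ℝ G] {Φ : Set E} {Ψ : Set F} {Θ : Set G} (h₁ : RootIso Φ Ψ)
    (h₂ : RootIso Ψ Θ) : RootIso Φ Θ := by
  obtain ⟨e, rfl⟩ := h₁
  obtain ⟨f, rfl⟩ := h₂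
  exact ⟨e.trans f, by rw [← Set.image_comp]; rfl⟩

theorem rootIso_of_mem_iff {E F : Type*} [AddCommGroup E] [Module ℝ E] [AddCommGroup F]
    [Module ℝ F] {Φ : Set E} {Ψ : Set F} (e : E ≃ₗ[ℝ] F) (h : ∀ z, z ∈ Φ ↔ e z ∈ Ψ) :
    RootIso Φ Ψ := by
  refine ⟨e, ?_⟩
  ext y
  constructor
  · rintro ⟨z, hz, rfl⟩
    exact (h z).1 hz
  · intro hy
    exact ⟨e.symm y, (h _).2 (by rwa [e.apply_symm_apply]), e.apply_symm_apply y⟩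

theorem rootIso_rootsB_one : RootIso (rootsB 1) rootsA₁ := by
  refine rootIso_of_mem_iff (LinearEquiv.funUnique (Fin 1) ℝ ℝ) fun z => ?_
  simp [rootsB, unitRoots, middleRoots, rootsA₁, funext_iff, Subsingleton.elim _ (0 : Fin 1)]

theorem rootIso_rootsC_one : RootIso (rootsC 1) rootsA₁ := by
  refine rootIso_of_mem_iff ((LinearEquiv.smulOfNeZero ℝ (Fin 1 → ℝ) (1 / 2) (by norm_num)).trans
    (LinearEquiv.funUnique (Fin 1) ℝ ℝ)) fun z => ?_
  have h1 : ∀ t : ℝ, 2⁻¹ * t = 1 ↔ t = 2 := fun t => by constructor <;> intro h <;> linarith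
  have h2 : ∀ t : ℝ, 2⁻¹ * t = -1 ↔ t = -2 := fun t => by constructor <;> intro h <;> linarith
  simp [rootsC, doubleRoots, middleRoots, rootsA₁, funext_iff, h1, h2]

/-- The rotation by `45` degrees, scaled by `√2 / 2`. -/
noncomputable def rotateScale : (Fin 2 → ℝ) ≃ₗ[ℝ] (Fin 2 → ℝ) where
  toFun v := ![(v 0 + v 1) / 2, (v 0 - v 1) / 2]
  map_add' v w := by ext i; fin_cases i <;> simp <;> ring
  map_smul' c v := by ext i; fin_cases i <;> simp <;> ring
  invFun v := ![v 0 + v 1, v 0 - v 1]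
  left_inv v := by ext i; fin_cases i <;> simp <;> ring
  right_inv v := by ext i; fin_cases i <;> simp

/-- `rotateScale` takes the middle roots to the unit roots and the double roots to the middle roots.
-/
theorem rootIso_rootsC_two : RootIso (rootsC 2) (rootsB 2) := by
  refine rootIso_of_mem_iff rotateScale fun z => ?_
  simp only [rootsC, rootsB, unitRoots, middleRoots, doubleRoots, rotateScale, Set.mem_union,
    Set.mem_ofPred_eq, Fin.exists_fin_two, funext_iff, Fin.forall_fin_two, LinearEquiv.coe_mk,
    LinearMap.coe_mk, AddHom.coe_mk]
  simp
  grind (splits := 40)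

/-! ### Removing one orbit in the presence of proportional roots -/

namespace IsRootSet

variable {b : LinearMap.BilinForm ℝ E} {Φ Ψ : Set E} {a γ ψ z : E}

/-- If two roots are proportional, but not equal up to sign, then one of them is twice the other
up to sign. -/
theorem exists_two_smul_mem (h : IsRootSet b Φ) (hγ : γ ∈ Φ) (hψ : ψ ∈ Φ) (h1 : ψ ≠ γ)
    (h2 : ψ ≠ -γ) (hprop : b ψ γ ^ 2 = b ψ ψ * b γ γ) :
    ∃ a ∈ Φ, (2 : ℝ) • a ∈ Φ ∧ (γ = a ∨ γ = (2 : ℝ) • a) := by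
  obtain ⟨m, hm⟩ := h.exists_cartan ψ hψ γ hγ
  obtain ⟨n, hn⟩ := h.exists_cartan γ hγ ψ hψ
  have hγp := h.apply_self_pos hγ
  have hψp := h.apply_self_pos hψ
  rw [h.comm γ ψ] at hn
  have hmn : m * n = 4 := by
    have h3 : ((m * n : ℝ) - 4) * (b ψ ψ * b γ γ) = 0 := by
      linear_combination (-(n : ℝ) * b ψ ψ) * hm - 2 * b ψ γ * hn + 4 * hprop
    have h4 := (mul_eq_zero.1 h3).resolve_right (mul_pos hψp hγp).ne'
    have h5 : (m * n : ℝ) = 4 := by linarith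
    exact_mod_cast h5
  have hψγ : ψ = (m / 2 : ℝ) • γ := by
    have h3 : b ψ γ = (m / 2 : ℝ) * b γ γ := by linarith
    refine h.eq_smul h3 (mul_right_cancel₀ hγp.ne' ?_)
    rw [← hprop, h3]
    ring
  have hdvd : m ∣ 4 := ⟨n, hmn.symm⟩
  have hle : m ≤ 4 := Int.le_of_dvd (by norm_num) hdvd
  have hge : -4 ≤ m := by
    have := Int.le_of_dvd (by norm_num) (neg_dvd.2 hdvd)
    omega
  -- Only divisors of `4` survive: `±2` would give `ψ = ±γ`, `±4` give `ψ = ±2γ`, and `±1` give `γ =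
  -- ±2ψ`.
  interval_cases m <;> norm_num at hψγ hdvd
  · exact ⟨γ, hγ, by simpa [hψγ] using h.neg_mem hψ, Or.inl rfl⟩
  · exact absurd hψγ h2
  · refine ⟨-ψ, h.neg_mem hψ, ?_, ?_⟩
    · rw [show (2 : ℝ) • -ψ = γ by rw [hψγ]; module]
      exact hγ
    · right
      rw [hψγ]
      module
  · refine ⟨ψ, hψ, ?_, ?_⟩
    · rw [show (2 : ℝ) • ψ = γ by rw [hψγ]; module]
      exact hγ
    · right
      rw [hψγ]
      module
  · exact absurd hψγ h1
  · exact ⟨γ, hγ, by simpa [hψγ] using hψ, Or.inl rfl⟩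

/-- Removing one orbit of roots of one length from an irreducible root system, when a root
proportional to a removed one remains. -/
theorem exists_rootIso [FiniteDimensional ℝ E] (h : IsRootSet b Φ) (hΨΦ : Ψ ⊆ Φ)
    (hΨ : ∀ x ∈ Φ, ∀ y ∈ Ψ, reflection b x y ∈ Ψ) (hγ : γ ∈ Φ) (hγΨ : γ ∉ Ψ)
    (hlen : ∀ x ∈ Φ, x ∉ Ψ → b x x = b γ γ) (hψ : ψ ∈ Ψ) (hprop : b ψ γ ^ 2 = b ψ ψ * b γ γ) :
    ∃ l, 1 ≤ l ∧ RootIso Φ (rootsBC l) ∧ (RootIso Ψ (rootsB l) ∨ RootIso Ψ (rootsC l)) := by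
  have hneg : ∀ x, -x ∈ Ψ → x ∈ Ψ := fun x hx => by
    have := hΨ _ (hΨΦ hx) _ hx
    rwa [reflection_self (h.apply_self_ne_zero (hΨΦ hx)), neg_neg] at this
  obtain ⟨a, ha, ha2, hγa⟩ := h.exists_two_smul_mem hγ (hΨΦ hψ) (fun h1 => hγΨ (h1 ▸ hψ))
    (fun h1 => hγΨ (hneg _ (h1 ▸ hψ))) hprop
  obtain ⟨l, e, he, horth, hX⟩ := h.exists_basis ha ha2
  obtain ⟨i, hi⟩ := hX a ⟨ha, ha2, rfl⟩
  have hmem := fun z => h.mem_iff (z := z) ha ha2 he horth hX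
  have hap := h.apply_self_pos ha
  -- The squared lengths of the three kinds of roots are in ratio `1 : 2 : 4`, so the removed roots,
  -- all of one length, are of one kind.
  have hunit : ∀ z, e.equivFun z ∈ unitRoots l → b z z = b a a := by
    intro z hz
    obtain ⟨j, rfl | rfl⟩ := (equivFun_mem_unitRoots e).1 hz <;> simp [(he j).2.2]
  have hdouble : ∀ z, e.equivFun z ∈ doubleRoots l → b z z = 4 * b a a := by
    intro z hz
    obtain ⟨j, rfl | rfl⟩ := (equivFun_mem_doubleRoots e).1 hz <;> simp [(he j).2.2] <;> ring
  have hmiddle : ∀ z, e.equivFun z ∈ middleRoots l → b z z = 2 * b a a := by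
    intro z hz
    obtain ⟨j, k, hjk, rfl | rfl | rfl⟩ := (equivFun_mem_middleRoots e).1 hz <;>
      simp [(he j).2.2, (he k).2.2, horth j k hjk, horth k j hjk.symm] <;> ring
  have hmove : ∀ j, ∃ x ∈ Φ, ∀ t : ℝ, reflection b x (t • e j) = t • e i ∨ t • e j = t • e i := by
    intro j
    by_cases hij : i = j
    · exact ⟨a, ha, fun t => Or.inr (by rw [hij])⟩
    · refine ⟨e i - e j, (h.add_mem_and_sub_mem he horth hij
        (Or.inl (h.add_mem ha ha2 he horth hX hij))).2, fun t => Or.inl ?_⟩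
      rw [map_smul, h.reflection_basis_eq he horth hij]
  have hout : ∀ (t : ℝ) j, t • e i ∉ Ψ → t • e j ∉ Ψ := by
    intro t j ht hj
    obtain ⟨x, hx, hxt⟩ := hmove j
    rcases hxt t with h1 | h1
    · exact ht (h1 ▸ hΨ x hx _ hj)
    · exact ht (h1 ▸ hj)
  refine ⟨l, i.pos, rootIso_of_mem_iff e.equivFun hmem, ?_⟩
  rcases hγa with hγa | hγa
  · right
    refine rootIso_of_mem_iff e.equivFun fun z => ⟨fun hz => ?_, fun hz => ?_⟩
    · rcases (hmem z).1 (hΨΦ hz) with (h1 | h1) | h1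
      · exfalso
        have hei : (1 : ℝ) • e i ∉ Ψ := by
          rw [one_smul]
          intro h2
          rcases hi with hi | hi
          · exact hγΨ (by rwa [hγa, hi])
          · exact hγΨ (by rw [hγa, hi]; exact hneg _ (by rwa [neg_neg]))
        obtain ⟨j, rfl | rfl⟩ := (equivFun_mem_unitRoots e).1 h1
        · exact hout 1 j hei (by rwa [one_smul])
        · exact hout 1 j hei (by rw [one_smul]; exact hneg _ hz)
      · exact Or.inl h1
      · exact Or.inr h1
    · by_contra hzΨ
      rcases hz with hz | hz
      · have h1 := hlen z ((hmem z).2 (Or.inl (Or.inr hz))) hzΨ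
        rw [hmiddle z hz, hγa] at h1
        linarith
      · have h1 := hlen z ((hmem z).2 (Or.inr hz)) hzΨ
        rw [hdouble z hz, hγa] at h1
        linarith
  · left
    have hγγ : b γ γ = 4 * b a a := by rw [hγa]; simp; ring
    refine rootIso_of_mem_iff e.equivFun fun z => ⟨fun hz => ?_, fun hz => ?_⟩
    · rcases (hmem z).1 (hΨΦ hz) with h1 | h1
      · exact h1
      · exfalso
        have hei : (2 : ℝ) • e i ∉ Ψ := by
          intro h2
          rcases hi with hi | hi
          · exact hγΨ (by rwa [hγa, hi])
          · exact hγΨ (by rw [hγa, hi]; exact hneg _ (by rwa [smul_neg, neg_neg]))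
        obtain ⟨j, rfl | rfl⟩ := (equivFun_mem_doubleRoots e).1 h1
        · exact hout 2 j hei hz
        · exact hout 2 j hei (hneg _ (by rwa [← neg_smul]))
    · by_contra hzΨ
      have h1 := hlen z ((hmem z).2 (Or.inl hz)) hzΨ
      rcases hz with hz | hz
      · rw [hunit z hz, hγγ] at h1
        linarith
      · rw [hmiddle z hz, hγγ] at h1
        linarith

end IsRootSet

/-! ### The quotient root system -/

section quotient

variable {𝒱 : Type*} [AddCommGroup 𝒱] [Module ℝ 𝒱] {B : LinearMap.BilinForm ℝ 𝒱}

/-- The form induced on `𝒱 / 𝒱⁰`. -/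
def quotientForm (B : LinearMap.BilinForm ℝ 𝒱) (hB : B.IsPosSemidef) :
    LinearMap.BilinForm ℝ (𝒱 ⧸ nullspace B) :=
  LinearMap.liftQ₂ (nullspace B) (nullspace B) B le_rfl fun v hv => by
    rw [LinearMap.mem_ker]
    ext w
    rw [LinearMap.flip_apply, hB.isSymm.eq, LinearMap.mem_ker.1 hv]

theorem quotientForm_mk (hB : B.IsPosSemidef) (v w : 𝒱) :
    quotientForm B hB ((nullspace B).mkQ v) ((nullspace B).mkQ w) = B v w := rfl

theorem reflection_quotientForm (hB : B.IsPosSemidef) (α v : 𝒱) :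
    reflection (quotientForm B hB) ((nullspace B).mkQ α) ((nullspace B).mkQ v) =
      (nullspace B).mkQ (reflection B α v) := by
  rw [reflection_apply, reflection_apply, quotientForm_mk, quotientForm_mk, map_sub, map_smul]

theorem IsEARS.isRootSet [TopologicalSpace 𝒱] {R : Set 𝒱} (hB : B.IsPosSemidef)
    (hR : IsEARS B R) : IsRootSet (quotientForm B hB) (quotientRoots B R) := by
  have hsurj := Submodule.mkQ_surjective (nullspace B)
  refine ⟨⟨⟨fun x y => ?_⟩, ⟨fun x => ?_⟩⟩, fun x hx => ?_, ?_, ?_, ?_, ?_, ?_⟩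
  · obtain ⟨v, rfl⟩ := hsurj x
    obtain ⟨w, rfl⟩ := hsurj y
    exact hB.isSymm.eq v w
  · obtain ⟨v, rfl⟩ := hsurj x
    exact hB.isNonneg.nonneg v
  · obtain ⟨v, rfl⟩ := hsurj x
    rw [quotientForm_mk, ← mem_nullspace hB] at hx
    simpa using hx
  · rintro ⟨α, hα, h0⟩
    exact hα.2 (by rw [← quotientForm_mk hB, h0]; simp)
  · rw [quotientRoots, ← Submodule.map_span, hR.span_anisotropicPart hB, Submodule.map_top,
      LinearMap.range_eq_top.2 hsurj]
  · rintro _ ⟨α, hα, rfl⟩ _ ⟨γ, hγ, rfl⟩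
    rw [reflection_quotientForm]
    exact ⟨_, hR.reflection_mem_anisotropicPart hB hα hγ, rfl⟩
  · rintro _ ⟨α, hα, rfl⟩ _ ⟨γ, hγ, rfl⟩
    obtain ⟨n, hn, -⟩ := hR.exists_cartan hB hγ hα.1
    exact ⟨n, hn⟩
  · rintro Φ₁ hsub ⟨x, hx⟩ horth
    by_contra hne
    obtain ⟨y, hy, hy1⟩ : ∃ y ∈ quotientRoots B R, y ∉ Φ₁ := by
      by_contra! hcon
      exact hne (Set.Subset.antisymm hsub hcon)
    obtain ⟨α, hα, rfl⟩ := hsub hx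
    obtain ⟨γ, hγ, rfl⟩ := hy
    refine hR.irreducible ⟨{α ∈ anisotropicPart B R | (nullspace B).mkQ α ∈ Φ₁},
      {α ∈ anisotropicPart B R | (nullspace B).mkQ α ∉ Φ₁}, ⟨α, hα, hx⟩, ⟨γ, hγ, hy1⟩, ?_, ?_, ?_⟩
    · exact Set.disjoint_left.2 fun v h1 h2 => h2.2 h1.2
    · ext v
      by_cases hv : (nullspace B).mkQ v ∈ Φ₁ <;> simp_all
    · rintro v ⟨hv, hv1⟩ w ⟨hw, hw1⟩
      exact horth _ hv1 _ ⟨w, hw, rfl⟩ hw1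

end quotient

/-! ### Comparison of types and the theorem -/

theorem exists_rootIso_of_isWeylStable {𝒱 : Type*} [AddCommGroup 𝒱] [Module ℝ 𝒱]
    [FiniteDimensional ℝ 𝒱] [TopologicalSpace 𝒱] {B : LinearMap.BilinForm ℝ 𝒱}
    (hB : B.IsPosSemidef) {R R' S : Set 𝒱} (hR : IsEARS B R) (hS : IsWeylStable B R S) {β : 𝒱}
    (hβ : β ∈ anisotropicPart B R)
    (hgen : linearWeyl B (anisotropicPart B R) ≤ linearWeyl B S)
    (horb : ∀ α ∈ anisotropicPart B R, α ∉ S →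
      ∃ g ∈ linearWeyl B (anisotropicPart B R), g β = α)
    (hR' : anisotropicPart B R' = S) :
    SameType B R R' ∨ ∃ l, 1 ≤ l ∧ HasType B R (rootsBC l) ∧
      (HasType B R' (rootsB l) ∨ HasType B R' (rootsC l)) := by
  have hroot := hR.isRootSet hB
  have hsub : quotientRoots B R' ⊆ quotientRoots B R := by
    rw [quotientRoots, quotientRoots, hR']
    exact Set.image_mono hS.subset
  have hrefl : ∀ α ∈ anisotropicPart B R, ∀ v : 𝒱, (nullspace B).mkQ v ∈ quotientRoots B R' →
      (nullspace B).mkQ (reflection B α v) ∈ quotientRoots B R' := by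
    rintro α hα v ⟨γ, hγ, h⟩
    rw [← reflection_quotientForm hB, ← h, reflection_quotientForm]
    rw [hR'] at hγ
    exact ⟨_, hR' ▸ hS.reflection_mem α hα γ hγ, rfl⟩
  -- Distinct roots may share a class modulo `𝒱⁰`, so removing `β` need not remove its class.
  by_cases hβ' : (nullspace B).mkQ β ∈ quotientRoots B R'
  · left
    have : quotientRoots B R = quotientRoots B R' := by
      refine Set.Subset.antisymm ?_ hsub
      rintro _ ⟨α, hα, rfl⟩
      by_cases hαS : α ∈ S
      · exact ⟨α, hR' ▸ hαS, rfl⟩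
      · obtain ⟨g, hg, rfl⟩ := horb α hα hαS
        exact apply_mem_of_mem_linearWeyl
          (T := {v | (nullspace B).mkQ v ∈ quotientRoots B R'}) hrefl hg hβ'
    exact ⟨LinearEquiv.refl ℝ _, by rw [this]; exact Set.image_id _⟩
  · right
    obtain ⟨α, hα, hαβ⟩ := hS.exists_proportional hB hR hβ (hgen (reflection_mem_linearWeyl hβ))
    refine hroot.exists_rootIso hsub ?_ ⟨β, hβ, rfl⟩ hβ' ?_ (ψ := (nullspace B).mkQ α)
      ⟨α, hR' ▸ hα, rfl⟩ hαβ
    · rintro _ ⟨γ, hγ, rfl⟩ y hy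
      obtain ⟨v, rfl⟩ := Submodule.mkQ_surjective _ y
      rw [reflection_quotientForm]
      exact hrefl γ hγ v hy
    · rintro _ ⟨γ, hγ, rfl⟩ hγ'
      have hγS : γ ∉ S := fun h => hγ' ⟨γ, hR' ▸ h, rfl⟩
      obtain ⟨g, hg, rfl⟩ := horb γ hγ hγS
      exact apply_of_mem_linearWeyl hB hg β β

end EARS

theorem mainTheorem12 {𝒱 : Type*} [AddCommGroup 𝒱] [Module ℝ 𝒱] [FiniteDimensional ℝ 𝒱]
    [TopologicalSpace 𝒱] [IsTopologicalAddGroup 𝒱] [ContinuousSMul ℝ 𝒱] [T2Space 𝒱]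
    (B : LinearMap.BilinForm ℝ 𝒱) (hB : B.IsPosSemidef)
    (D : Submodule ℝ 𝒱) (hD : IsCompl (EARS.nullspace B) D)
    (R : Set 𝒱) (hR : EARS.IsEARS B R)
    (β : 𝒱) (hβ : β ∈ EARS.anisotropicPart B R)
    (hgen : EARS.reflectionGroup B D hD (EARS.removeOrbit B D hD R β) =
      EARS.weylGroup B D hD R) :
    (∃ R' : Set 𝒱, EARS.IsEARS B R' ∧
      EARS.anisotropicPart B R' = EARS.removeOrbit B D hD R β) ∧
    ∀ R' : Set 𝒱, EARS.IsEARS B R' →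
      EARS.anisotropicPart B R' = EARS.removeOrbit B D hD R β →
      EARS.SameType B R R' ∨
      (EARS.HasType B R (EARS.rootsBC 1) ∧ EARS.HasType B R' EARS.rootsA₁) ∨
      (EARS.HasType B R (EARS.rootsBC 2) ∧ EARS.HasType B R' (EARS.rootsB 2)) ∨
      (∃ l : ℕ, 3 ≤ l ∧ EARS.HasType B R (EARS.rootsBC l) ∧
        (EARS.HasType B R' (EARS.rootsB l) ∨ EARS.HasType B R' (EARS.rootsC l))) := by
  have hS := EARS.isWeylStable_removeOrbit (D := D) (hD := hD) hB hR β
  have hgen' := EARS.linearWeyl_le_of_reflectionGroup_le hgen.ge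
  have horb : ∀ α ∈ EARS.anisotropicPart B R, α ∉ EARS.removeOrbit B D hD R β →
      ∃ g ∈ EARS.linearWeyl B (EARS.anisotropicPart B R), g β = α := by
    intro α hα h
    by_contra! hcon
    exact h (EARS.mem_removeOrbit.2 ⟨hα, hcon⟩)
  refine ⟨⟨_, hS.isEARS_withIsotropic hB hR hβ hgen' horb, hS.anisotropicPart_withIsotropic⟩,
    fun R' _ hR' => ?_⟩
  rcases EARS.exists_rootIso_of_isWeylStable hB hR hS hβ hgen' horb hR' with
    h | ⟨l, hl, hBC, h⟩
  · exact Or.inl h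
  right
  -- In ranks `1` and `2` the types `B` and `C` coincide.
  obtain rfl | rfl | hl : l = 1 ∨ l = 2 ∨ 3 ≤ l := by omega
  · exact Or.inl ⟨hBC, h.elim (fun h => h.trans EARS.rootIso_rootsB_one)
      fun h => h.trans EARS.rootIso_rootsC_one⟩
  · exact Or.inr (Or.inl ⟨hBC, h.elim id fun h => h.trans EARS.rootIso_rootsC_two⟩)
  · exact Or.inr (Or.inr ⟨l, hl, hBC, h⟩)
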